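/- **Theorem 5.** *Class $\mathbb M$ chains.* Let $M,j_0\ge 0$ be integers and $\mathcal N$ a finite set. A class $\mathbb M$ Markov chain is an ergodic continuous time Markov chain on $\mathcal N\cup\mathcal R$, $\mathcal R=\{(m,j):0\le m\le M,\ j\ge j_0\}$ ($m$ is the phase, $j$ the level), whose transition rates $q(\cdot,\cdot)$ satisfy: rates between states of $\mathcal N$ are arbitrary; transitions from $\mathcal N$ to $\mathcal R$ and from $\mathcal R$ to $\mathcal N$ enter, respectively leave, $\mathcal R$ only in level $j_0$; $q((m,j),(m,j+1))=\lambda_m$ for $j\ge j_0$ and $q((m,j),(m,j-1))=\mu_m$ for $j\ge j_0+1$; for $m<i$ and $\Delta\in\{-1,0,1\}$, $q((m,j),(i,j+\Delta))=\alpha_m\langle i-m;\Delta\rangle$ whenever $j\ge j_0$ and $j+\Delta\ge j_0$; there are no other transitions inside $\mathcal R$. Put $$\alpha_m=\sum_{i=m+1}^M\sum_{\Delta=-1}^1\alpha_m\langle i-m;\Delta\rangle,\qquad \phi_m(s)=\frac{s+\lambda_m+\mu_m-\sqrt{(s+\lambda_m+\mu_m)^2-4\lambda_m\mu_m}}{2\lambda_m},$$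 $$r_m=\frac{\lambda_m}{\mu_m}\phi_m(\alpha_m),\qquad \Omega_m=\frac{r_m}{\lambda_m(1-r_m\phi_m(\alpha_m))},$$ and abbreviate $\phi_m=\phi_m(\alpha_m)$. Let $\pi$ be the limiting probability distribution of the chain. *Statement.* Suppose that all $\lambda_m,\mu_m>0$ and $r_0=r_1=\cdots=r_{M-1}\ne r_M$ (so $M\ge1$). Then there are constants $\{c_{m,k}\}_{0\le k\le m\le M}$ such that for all $j\ge j_0$ (with $\binom{-1}{0}=1$) $$\pi_{(m,j)}=\sum_{k=0}^m c_{m,k}\binom{j-j_0-1+k}{k}r_0^{\,j-j_0}\qquad(0\le m\le M-1),$$ $$\pi_{(M,j)}=\sum_{k=0}^{M-1}c_{M,k}\binom{j-j_0-1+k}{k}r_0^{\,j-j_0}+c_{M,M}\,r_M^{\,j-j_0},$$ and these constants, together with the values $\pi_{(m,j_0)}$ $(0\le m\le M)$ and $\pi_x$ $(x\in\mathcal N)$, satisfy the following system of linear equations: * $c_{m,0}=\pi_{(m,j_0)}$ for $0\le m<M$; * for $1\le k<m<M$, $$c_{m,k}=\Omega_m r_0\sum_{u=k}^{m-1}\sum_{i=u}^{m-1}c_{i,u}\sum_{\Delta=-1}^1\frac{\alpha_i\langle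 m-i;\Delta\rangle\,\phi_m^{\Delta+1}}{(1-r_0\phi_m)^{u+1-k}}+\Omega_m\sum_{i=k-1}^{m-1}c_{i,k-1}\sum_{\Delta=-1}^1\alpha_i\langle m-i;\Delta\rangle r_0^{-\Delta}-\frac1{\lambda_m}\sum_{i=k}^{m-1}c_{i,k}\,\alpha_i\langle m-i;1\rangle;$$ * $c_{m,m}=c_{m-1,m-1}\,\Omega_m\sum_{\Delta=-1}^1\alpha_{m-1}\langle1;\Delta\rangle r_0^{-\Delta}$ for $1\le m<M$; * for $0\le k<M$, $$c_{M,k}=-\sum_{i=k}^{M-1}c_{i,k}\frac{\alpha_i\langle M-i;1\rangle}{\lambda_M}+\sum_{u=k}^{M-1}\sum_{i=u}^{M-1}c_{i,u}\Omega_M r_0\sum_{\Delta=-1}^1\alpha_i\langle M-i;\Delta\rangle\left[\frac1{(1-r_0)^{u+1-k}}-\frac1{r_M^{\Delta+1}\left(1-\frac{r_0}{r_M}\right)^{u+1-k}}\right];$$ * $c_{M,M}=\pi_{(M,j_0)}-c_{M,0}$; * the balance equations of the states $(m,j_0)$, $0\le m\le M$: $$\pi_{(m,j_0)}\Big(\lambda_m+\sum_{i=m+1}^M\sum_{\Delta=0}^1\alpha_m\langle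 i-m;\Delta\rangle+\sum_{x\in\mathcal N}q((m,j_0),x)\Big)=\mu_m\pi_{(m,j_0+1)}+\sum_{x\in\mathcal N}q(x,(m,j_0))\pi_x+\sum_{i=0}^{m-1}\sum_{\Delta=-1}^0\alpha_i\langle m-i;\Delta\rangle\pi_{(i,j_0-\Delta)},$$ in which $\pi_{(m,j_0+1)}$ stands for $\sum_{k=0}^m c_{m,k}r_0$ if $m<M$ and for $\sum_{k=0}^{M-1}c_{M,k}r_0+c_{M,M}r_M$ if $m=M$; * the balance equations of the states $x\in\mathcal N$ (with $q(x,x)=0$): $$\pi_x\Big(\sum_{m=0}^M q(x,(m,j_0))+\sum_{y\in\mathcal N}q(x,y)\Big)=\sum_{m=0}^M q((m,j_0),x)\pi_{(m,j_0)}+\sum_{y\in\mathcal N}q(y,x)\pi_y;$$ * the normalization constraint $$\sum_{x\in\mathcal N}\pi_x+\sum_{m=0}^{M-1}\Big(\frac{c_{m,0}}{1-r_0}+\sum_{k=1}^m\frac{c_{m,k}\,r_0}{(1-r_0)^{k+1}}\Big)+\frac{c_{M,0}}{1-r_0}+\sum_{k=1}^{M-1}\frac{c_{M,k}\,r_0}{(1-r_0)^{k+1}}+\frac{c_{M,M}}{1-r_M}=1.$$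 -/

import Mathlib

open Filter Topology

noncomputable section

/-- State space `𝒩 ∪ ℛ`: the finite nonrepeating portion `N`, and the repeating portion
`{(m, j) : 0 ≤ m ≤ M, j ≥ j₀}` of pairs (phase, level). -/
abbrev MState (N : Type*) (M j₀ : ℕ) : Type _ := N ⊕ (Fin (M + 1) × {j : ℕ // j₀ ≤ j})

/-- The state `(m, j)` of the repeating portion. -/
abbrev MState.rep {N : Type*} {M j₀ : ℕ} (m : Fin (M + 1)) (j : ℕ) (hj : j₀ ≤ j) :
    MState N M j₀ := Sum.inr (m, ⟨j, hj⟩)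

/-- The state `x` of the nonrepeating portion. -/
abbrev MState.non {N : Type*} {M j₀ : ℕ} (x : N) : MState N M j₀ := Sum.inl x

/-- `P t x y` is the transition function of a continuous time Markov chain on the countable state
space `S` whose transition rate from `x` to `y ≠ x` is `q x y` (with the convention `q x x = 0`):
`P` is a semigroup of stochastic matrices, whose derivative at `t = 0` is the generator with
off-diagonal entries `q x y` and diagonal entries minus the total outgoing rates. -/
structure IsTransitionFunction {S : Type*} (q : S → S → ℝ) (P : ℝ → S → S → ℝ) : Prop where
  nonneg : ∀ t, 0 ≤ t → ∀ x y, 0 ≤ P t x y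
  row_sum : ∀ t, 0 ≤ t → ∀ x, HasSum (fun y => P t x y) 1
  zero_self : ∀ x, P 0 x x = 1
  zero_of_ne : ∀ x y, x ≠ y → P 0 x y = 0
  chapman_kolmogorov : ∀ s t, 0 ≤ s → 0 ≤ t → ∀ x y,
    HasSum (fun z => P s x z * P t z y) (P (s + t) x y)
  rate_summable : ∀ x, Summable (fun y => q x y)
  deriv_of_ne : ∀ x y, x ≠ y →
    HasDerivWithinAt (fun t => P t x y) (q x y) (Set.Ici 0) 0
  deriv_self : ∀ x, HasDerivWithinAt (fun t => P t x x) (-∑' y, q x y) (Set.Ici 0) 0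

/-- `π` is the limiting probability distribution of the chain: a probability distribution to which
the law at time `t` converges as `t → ∞`, from every initial state. -/
structure IsLimitingDistribution {S : Type*} (P : ℝ → S → S → ℝ) (π : S → ℝ) : Prop where
  hasSum_one : HasSum π 1
  tendsto : ∀ x y, Tendsto (fun t => P t x y) atTop (𝓝 (π y))

/-- The chain is ergodic: it is irreducible, and it has a limiting probability distribution
(that is, it is positive recurrent). -/
structure IsErgodicChain {S : Type*} (P : ℝ → S → S → ℝ) : Prop where
  irreducible : ∀ x y, ∃ t, 0 ≤ t ∧ 0 < P t x y
  exists_limiting : ∃ π : S → ℝ, IsLimitingDistribution P π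

/-- The transition rates of a class `𝕄` Markov chain.  Here `q x y` is the transition rate from
`x` to `y`, and, in the repeating portion, `lam m = λ_m`, `mu m = μ_m` and
`alp m Δ₁ Δ₂ = α_m⟨Δ₁; Δ₂⟩`, the rate at which the phase increases from `m` to `m + Δ₁` while the
level changes by `Δ₂ ∈ {-1, 0, 1}`.  Only the values of `lam`, `mu`, `alp` at phases `≤ M` matter. -/
structure ClassM (N : Type*) (M j₀ : ℕ) where
  q : MState N M j₀ → MState N M j₀ → ℝ
  lam : ℕ → ℝ
  mu : ℕ → ℝ
  alp : ℕ → ℕ → ℤ → ℝ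
  q_nonneg : ∀ x y, 0 ≤ q x y
  q_self : ∀ x, q x x = 0
  -- from the nonrepeating portion one can enter the repeating portion only at level `j₀`
  q_non_rep : ∀ (x : N) (m : Fin (M + 1)) (j : ℕ) (hj : j₀ ≤ j), j₀ < j →
    q (MState.non x) (MState.rep m j hj) = 0
  -- from the repeating portion one can enter the nonrepeating portion only from level `j₀`
  q_rep_non : ∀ (x : N) (m : Fin (M + 1)) (j : ℕ) (hj : j₀ ≤ j), j₀ < j →
    q (MState.rep m j hj) (MState.non x) = 0
  -- transitions within a phase
  q_right : ∀ (m : Fin (M + 1)) (j : ℕ) (hj : j₀ ≤ j),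
    q (MState.rep m j hj) (MState.rep m (j + 1) (Nat.le_succ_of_le hj)) = lam m
  q_left : ∀ (m : Fin (M + 1)) (j : ℕ) (hj : j₀ ≤ j),
    q (MState.rep m (j + 1) (Nat.le_succ_of_le hj)) (MState.rep m j hj) = mu m
  -- transitions to a higher phase
  q_up_left : ∀ (m i : Fin (M + 1)), m < i → ∀ (j : ℕ) (hj : j₀ ≤ j),
    q (MState.rep m (j + 1) (Nat.le_succ_of_le hj)) (MState.rep i j hj)
      = alp m ((i : ℕ) - m) (-1)
  q_up_stay : ∀ (m i : Fin (M + 1)), m < i → ∀ (j : ℕ) (hj : j₀ ≤ j),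
    q (MState.rep m j hj) (MState.rep i j hj) = alp m ((i : ℕ) - m) 0
  q_up_right : ∀ (m i : Fin (M + 1)), m < i → ∀ (j : ℕ) (hj : j₀ ≤ j),
    q (MState.rep m j hj) (MState.rep i (j + 1) (Nat.le_succ_of_le hj))
      = alp m ((i : ℕ) - m) 1
  -- transitions are unidirectional in phase and skip-free in level
  q_unidirectional : ∀ (m i : Fin (M + 1)), i < m → ∀ (j l : ℕ) (hj : j₀ ≤ j) (hl : j₀ ≤ l),
    q (MState.rep m j hj) (MState.rep i l hl) = 0
  q_skip_free : ∀ (m i : Fin (M + 1)) (j l : ℕ) (hj : j₀ ≤ j) (hl : j₀ ≤ l),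
    (j + 1 < l ∨ l + 1 < j) → q (MState.rep m j hj) (MState.rep i l hl) = 0

namespace ClassM

variable {N : Type*} {M j₀ : ℕ}

/-- `α_m`, the total rate of leaving phase `m` from a state `(m, j)` with `j ≥ j₀ + 1`. -/
def alpha (C : ClassM N M j₀) (m : ℕ) : ℝ :=
  ∑ i ∈ Finset.Icc (m + 1) M, ∑ Δ ∈ Finset.Icc (-1 : ℤ) 1, C.alp m (i - m) Δ

/-- `ρ_m = λ_m / μ_m`. -/
def rho (C : ClassM N M j₀) (m : ℕ) : ℝ := C.lam m / C.mu m

/-- `φ_m(s)`, the Laplace transform of the M/M/1 busy period with rates `λ_m`, `μ_m`. -/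
def phi (C : ClassM N M j₀) (m : ℕ) (s : ℝ) : ℝ :=
  (s + C.lam m + C.mu m - √((s + C.lam m + C.mu m) ^ 2 - 4 * C.lam m * C.mu m)) / (2 * C.lam m)

/-- The base term `r_m`. -/
def r (C : ClassM N M j₀) (m : ℕ) : ℝ :=
  if 0 < C.mu m then C.rho m * C.phi m (C.alpha m) else C.lam m / (C.lam m + C.alpha m)

/-- `Ω_m`. -/
def Omega (C : ClassM N M j₀) (m : ℕ) : ℝ :=
  C.r m / (C.lam m * (1 - C.r m * C.phi m (C.alpha m)))

/-- The linear system, in the unknowns `c = (c_{m,k})_{0 ≤ k ≤ m ≤ M}`,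
`p m = π_{(m, j₀)}` (`0 ≤ m ≤ M`) and `w x = π_x` (`x ∈ 𝒩`), for a chain with
`r_0 = ⋯ = r_{M-1} ≠ r_M` and all `λ_m, μ_m > 0`. -/
structure LinearSystem [Fintype N] (C : ClassM N M j₀)
    (c : ℕ → ℕ → ℝ) (p : Fin (M + 1) → ℝ) (w : N → ℝ) : Prop where
  -- the coefficients of the phases `m < M`
  coeff_zero : ∀ m : Fin (M + 1), (m : ℕ) < M → c m 0 = p m
  coeff_mid : ∀ m k : ℕ, 1 ≤ k → k < m → m < M →
    c m k =
      C.Omega m * C.r 0 * (∑ u ∈ Finset.Ico k m, ∑ i ∈ Finset.Ico u m, c i u *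
        ∑ Δ ∈ Finset.Icc (-1 : ℤ) 1, C.alp i (m - i) Δ * C.phi m (C.alpha m) ^ (Δ + 1) /
          (1 - C.r 0 * C.phi m (C.alpha m)) ^ (u + 1 - k))
      + C.Omega m * (∑ i ∈ Finset.Ico (k - 1) m, c i (k - 1) *
        ∑ Δ ∈ Finset.Icc (-1 : ℤ) 1, C.alp i (m - i) Δ * C.r 0 ^ (-Δ))
      - 1 / C.lam m * ∑ i ∈ Finset.Ico k m, c i k * C.alp i (m - i) 1
  coeff_diag : ∀ m : ℕ, 1 ≤ m → m < M →
    c m m = c (m - 1) (m - 1) * C.Omega m *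
      ∑ Δ ∈ Finset.Icc (-1 : ℤ) 1, C.alp (m - 1) 1 Δ * C.r 0 ^ (-Δ)
  -- the coefficients of the phase `M`
  coeff_last : ∀ k : ℕ, k < M →
    c M k =
      - (∑ i ∈ Finset.Ico k M, c i k * (C.alp i (M - i) 1 / C.lam M))
      + ∑ u ∈ Finset.Ico k M, ∑ i ∈ Finset.Ico u M, c i u * C.Omega M * C.r 0 *
        ∑ Δ ∈ Finset.Icc (-1 : ℤ) 1, C.alp i (M - i) Δ *
          (1 / (1 - C.r 0) ^ (u + 1 - k)
            - 1 / (C.r M ^ (Δ + 1) * (1 - C.r 0 / C.r M) ^ (u + 1 - k)))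
  coeff_last_diag : c M M = p (Fin.last M) - c M 0
  -- the balance equations of the states `(m, j₀)`, with `π_{(m, j₀ + 1)}` written through `c`
  balance_rep : ∀ m : Fin (M + 1), (m : ℕ) < M →
    p m * (C.lam m
        + (∑ i ∈ Finset.Icc ((m : ℕ) + 1) M, ∑ Δ ∈ Finset.Icc (0 : ℤ) 1, C.alp m (i - m) Δ)
        + ∑ x : N, C.q (MState.rep m j₀ le_rfl) (MState.non x))
      = C.mu m * (∑ k ∈ Finset.range ((m : ℕ) + 1), c m k * C.r 0)
        + (∑ x : N, C.q (MState.non x) (MState.rep m j₀ le_rfl) * w x)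
        + ∑ i ∈ Finset.Iio m, (C.alp i ((m : ℕ) - i) 0 * p i
          + C.alp i ((m : ℕ) - i) (-1) * ∑ k ∈ Finset.range ((i : ℕ) + 1), c i k * C.r 0)
  balance_rep_last :
    p (Fin.last M) * (C.lam M
        + ∑ x : N, C.q (MState.rep (Fin.last M) j₀ le_rfl) (MState.non x))
      = C.mu M * ((∑ k ∈ Finset.range M, c M k * C.r 0) + c M M * C.r M)
        + (∑ x : N, C.q (MState.non x) (MState.rep (Fin.last M) j₀ le_rfl) * w x)
        + ∑ i ∈ Finset.Iio (Fin.last M), (C.alp i (M - i) 0 * p i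
          + C.alp i (M - i) (-1) * ∑ k ∈ Finset.range ((i : ℕ) + 1), c i k * C.r 0)
  -- the balance equations of the states `x ∈ 𝒩`
  balance_non : ∀ x : N,
    w x * ((∑ m : Fin (M + 1), C.q (MState.non x) (MState.rep m j₀ le_rfl))
        + ∑ y : N, C.q (MState.non x) (MState.non y))
      = (∑ m : Fin (M + 1), C.q (MState.rep m j₀ le_rfl) (MState.non x) * p m)
        + ∑ y : N, C.q (MState.non y) (MState.non x) * w y
  -- the normalization constraint, the sums over all levels being evaluated
  normalization :
    (∑ x : N, w x)
      + (∑ m ∈ Finset.range M, (c m 0 / (1 - C.r 0)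
          + ∑ k ∈ Finset.Icc 1 m, c m k * C.r 0 / (1 - C.r 0) ^ (k + 1)))
      + (c M 0 / (1 - C.r 0) + (∑ k ∈ Finset.Ico 1 M, c M k * C.r 0 / (1 - C.r 0) ^ (k + 1))
          + c M M / (1 - C.r M))
      = 1

end ClassM

end

/-!
A limiting distribution of a chain with bounded exit rates is positive and solves the balance
equations.  In the levels above `j₀` these say that `n ↦ π (m, j₀ + n)` satisfies a second order
recurrence with constant coefficients, driven by the lower phases, whose characteristic roots are
`r_m < 1` and `1 / φ_m ≥ 1`; since the probabilities tend to `0`, the solution is determined by its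
value at `n = 0`.  In the basis `binom (n - 1 + k) k * r ^ n` the recurrence becomes a triangular
system for the coefficients, which is solved by a finite geometric resolvent; every phase with the
same base `r` raises the degree by one, while the last phase, with another base, adds the term
`r_M ^ n`.
-/

section Chain

variable {S : Type*} {q : S → S → ℝ} {P : ℝ → S → S → ℝ} {π : S → ℝ}

/-- A positive probability distribution `π` that solves the balance equations of the rates `q`:
the flow into each state is the flow out of it.  It is the form in which a limiting distribution
enters the recurrences over the levels. -/
structure IsPositiveSteadyState (q : S → S → ℝ) (π : S → ℝ) : Prop where
  pos : ∀ x, 0 < π x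
  hasSum_one : HasSum π 1
  balance : ∀ y, HasSum (fun z => π z * q z y) (π y * ∑' z, q y z)

open Classical in
/-- The generator of the chain with transition rates `q`, whose diagonal entries are minus the total
exit rates. -/
noncomputable def generator (q : S → S → ℝ) (x y : S) : ℝ :=
  if x = y then -∑' z, q x z else q x y

namespace IsTransitionFunction

lemma le_one (hP : IsTransitionFunction q P) {t : ℝ} (ht : 0 ≤ t) (x y : S) : P t x y ≤ 1 :=
  le_hasSum (hP.row_sum t ht x) y fun z _ => hP.nonneg t ht x z

lemma add_le_one (hP : IsTransitionFunction q P) {t : ℝ} (ht : 0 ≤ t) {x y : S} (h : x ≠ y) :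
    P t x x + P t x y ≤ 1 := by
  classical
  have := sum_le_hasSum {x, y} (fun z _ => hP.nonneg t ht x z) (hP.row_sum t ht x)
  rwa [Finset.sum_pair h] at this

lemma one_sub_add_le (hP : IsTransitionFunction q P) {s t : ℝ} (hs : 0 ≤ s) (ht : 0 ≤ t) (x : S) :
    1 - P (s + t) x x ≤ (1 - P s x x) + (1 - P t x x) := by
  have stay : P s x x * P t x x ≤ P (s + t) x x :=
    le_hasSum (hP.chapman_kolmogorov s t hs ht x x) x fun z _ =>
      mul_nonneg (hP.nonneg s hs x z) (hP.nonneg t ht z x)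
  linarith [mul_nonneg (sub_nonneg.2 (hP.le_one hs x x)) (sub_nonneg.2 (hP.le_one ht x x))]

lemma one_sub_nat_mul_le (hP : IsTransitionFunction q P) {t : ℝ} (ht : 0 ≤ t) (x : S) (n : ℕ) :
    1 - P (n * t) x x ≤ n * (1 - P t x x) := by
  induction n with
  | zero => simp [hP.zero_self]
  | succ n ih =>
    push_cast
    rw [add_one_mul, add_one_mul]
    exact (hP.one_sub_add_le (by positivity) ht x).trans (by gcongr)

lemma tendsto_slope (hP : IsTransitionFunction q P) (x y : S) :
    Tendsto (slope (fun t => P t x y) 0) (𝓝[>] 0) (𝓝 (generator q x y)) := by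
  refine (hasDerivWithinAt_iff_tendsto_slope' (by simp)).1 (HasDerivWithinAt.Ioi_of_Ici ?_)
  by_cases h : x = y
  · subst h
    simpa only [generator, if_pos] using hP.deriv_self x
  · simpa only [generator, if_neg h] using hP.deriv_of_ne x y h

-- Subadditivity of `t ↦ 1 - P t x x` bounds it by its derivative at `0`, along `t / (n + 1) → 0`.
lemma one_sub_le (hP : IsTransitionFunction q P) {t : ℝ} (ht : 0 < t) (x : S) :
    1 - P t x x ≤ t * ∑' y, q x y := by
  have hseq : Tendsto (fun n : ℕ => t / ((n : ℝ) + 1)) atTop (𝓝[>] 0) := by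
    refine tendsto_nhdsWithin_iff.2 ⟨?_, Eventually.of_forall fun n => Set.mem_Ioi.2 ?_⟩
    · simpa only [mul_one_div, mul_zero] using
        (tendsto_one_div_add_atTop_nhds_zero_nat (𝕜 := ℝ)).const_mul t
    · positivity
  have hlim := ((hP.tendsto_slope x x).comp hseq).const_mul t
  rw [generator, if_pos rfl] at hlim
  suffices t * -∑' y, q x y ≤ P t x x - 1 by linarith
  refine le_of_tendsto hlim (Eventually.of_forall fun n => ?_)
  have hn : (0 : ℝ) < n + 1 := by positivity
  have hsub := hP.one_sub_nat_mul_le (div_pos ht hn).le x (n + 1)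
  rw [Nat.cast_add_one, mul_div_cancel₀ _ hn.ne'] at hsub
  have hslope : t * slope (fun t => P t x x) 0 (t / (n + 1))
      = (n + 1) * (P (t / (n + 1)) x x - 1) := by
    rw [slope_def_field, hP.zero_self, sub_zero, div_div_eq_mul_div, mul_div_cancel₀ _ ht.ne',
      mul_comm]
  rw [Function.comp, hslope]
  linarith

lemma norm_slope_le (hP : IsTransitionFunction q P) {t : ℝ} (ht : 0 < t) (x y : S) :
    ‖slope (fun t => P t x y) 0 t‖ ≤ ∑' z, q x z := by
  rw [slope_def_field, sub_zero, norm_div, Real.norm_of_nonneg ht.le, div_le_iff₀' ht]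
  refine le_trans ?_ (hP.one_sub_le ht x)
  by_cases h : x = y
  · subst h
    rw [hP.zero_self, norm_sub_rev, Real.norm_of_nonneg (sub_nonneg.2 (hP.le_one ht.le x x))]
  · rw [hP.zero_of_ne x y h, sub_zero, Real.norm_of_nonneg (hP.nonneg t ht.le x y)]
    linarith [hP.add_le_one ht.le h]

lemma norm_generator_le (hP : IsTransitionFunction q P) (x y : S) :
    ‖generator q x y‖ ≤ ∑' z, q x z :=
  le_of_tendsto (hP.tendsto_slope x y).norm
    (eventually_mem_nhdsWithin.mono fun _ ht => hP.norm_slope_le ht x y)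

end IsTransitionFunction

namespace IsLimitingDistribution

lemma nonneg (hπ : IsLimitingDistribution P π) (hP : IsTransitionFunction q P) (y : S) : 0 ≤ π y :=
  ge_of_tendsto (hπ.tendsto y y) ((eventually_ge_atTop 0).mono fun t ht => hP.nonneg t ht y y)

lemma tendsto_add (hπ : IsLimitingDistribution P π) (t : ℝ) (x y : S) :
    Tendsto (fun s => P (s + t) x y) atTop (𝓝 (π y)) :=
  (hπ.tendsto x y).comp (tendsto_atTop_add_const_right _ t tendsto_id)

lemma sum_mul_le (hπ : IsLimitingDistribution P π) (hP : IsTransitionFunction q P) {t : ℝ}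
    (ht : 0 ≤ t) (y : S) (F : Finset S) : ∑ z ∈ F, π z * P t z y ≤ π y := by
  have hlim : Tendsto (fun s => ∑ z ∈ F, P s y z * P t z y) atTop (𝓝 (∑ z ∈ F, π z * P t z y)) :=
    tendsto_finsetSum _ fun z _ => (hπ.tendsto y z).mul_const _
  refine le_of_tendsto_of_tendsto hlim (hπ.tendsto_add t y y)
    ((eventually_ge_atTop 0).mono fun s hs => ?_)
  exact sum_le_hasSum F (fun z _ => mul_nonneg (hP.nonneg s hs y z) (hP.nonneg t ht z y))
    (hP.chapman_kolmogorov s t hs ht y y)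

lemma le_sum_mul_add (hπ : IsLimitingDistribution P π) (hP : IsTransitionFunction q P) {t : ℝ}
    (ht : 0 ≤ t) (y : S) (F : Finset S) :
    π y ≤ ∑ z ∈ F, π z * P t z y + (1 - ∑ z ∈ F, π z) := by
  have hlim : Tendsto (fun s => ∑ z ∈ F, P s y z * P t z y + (1 - ∑ z ∈ F, P s y z)) atTop
      (𝓝 (∑ z ∈ F, π z * P t z y + (1 - ∑ z ∈ F, π z))) :=
    (tendsto_finsetSum _ fun z _ => (hπ.tendsto y z).mul_const _).add
      (tendsto_const_nhds.sub (tendsto_finsetSum _ fun z _ => hπ.tendsto y z))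
  refine le_of_tendsto_of_tendsto (hπ.tendsto_add t y y) hlim
    ((eventually_ge_atTop 0).mono fun s hs => ?_)
  have hescape : ∑ z ∈ F, (P s y z - P s y z * P t z y) ≤ 1 - P (s + t) y y :=
    sum_le_hasSum F
      (fun z _ => sub_nonneg.2 (mul_le_of_le_one_right (hP.nonneg s hs y z) (hP.le_one ht z y)))
      ((hP.row_sum s hs y).sub (hP.chapman_kolmogorov s t hs ht y y))
  rw [Finset.sum_sub_distrib] at hescape
  dsimp only
  linarith

lemma stationary (hπ : IsLimitingDistribution P π) (hP : IsTransitionFunction q P) {t : ℝ}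
    (ht : 0 ≤ t) (y : S) : HasSum (fun z => π z * P t z y) (π y) := by
  have hs : Summable fun z => π z * P t z y :=
    summable_of_sum_le (fun z => mul_nonneg (hπ.nonneg hP z) (hP.nonneg t ht z y))
      (hπ.sum_mul_le hP ht y)
  have hlim : Tendsto (fun F => ∑ z ∈ F, π z * P t z y + (1 - ∑ z ∈ F, π z)) atTop
      (𝓝 (∑' z, π z * P t z y + (1 - 1))) :=
    Tendsto.add hs.hasSum (tendsto_const_nhds.sub hπ.hasSum_one)
  rw [sub_self, add_zero] at hlim
  have hle : π y ≤ ∑' z, π z * P t z y :=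
    ge_of_tendsto hlim (Eventually.of_forall (hπ.le_sum_mul_add hP ht y))
  rw [hle.antisymm (hs.tsum_le_of_sum_le (hπ.sum_mul_le hP ht y))]
  exact hs.hasSum

lemma pos (hπ : IsLimitingDistribution P π) (hP : IsTransitionFunction q P)
    (hirr : ∀ x y, ∃ t, 0 ≤ t ∧ 0 < P t x y) (y : S) : 0 < π y := by
  obtain ⟨x, hx⟩ : ∃ x, 0 < π x := by
    by_contra! h
    exact zero_lt_one.not_ge (hasSum_le h hπ.hasSum_one hasSum_zero)
  obtain ⟨t, ht, hxy⟩ := hirr x y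
  exact (mul_pos hx hxy).trans_le (le_hasSum (hπ.stationary hP ht y) x
    fun z _ => mul_nonneg (hπ.nonneg hP z) (hP.nonneg t ht z y))

lemma hasSum_mul_slope (hπ : IsLimitingDistribution P π) (hP : IsTransitionFunction q P) {t : ℝ}
    (ht : 0 ≤ t) (y : S) : HasSum (fun z => π z * slope (fun t => P t z y) 0 t) 0 := by
  have h := ((hπ.stationary hP ht y).sub (hπ.stationary hP le_rfl y)).div_const t
  rw [sub_self, zero_div] at h
  refine h.congr_fun fun z => ?_
  rw [slope_def_field, sub_zero]
  ring

lemma hasSum_mul_generator (hπ : IsLimitingDistribution P π) (hP : IsTransitionFunction q P) {K : ℝ}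
    (hK : ∀ x, ∑' y, q x y ≤ K) (y : S) : HasSum (fun z => π z * generator q z y) 0 := by
  have hbound : ∀ z a, ‖a‖ ≤ ∑' w, q z w → ‖π z * a‖ ≤ π z * K := fun z a ha => by
    rw [norm_mul, Real.norm_of_nonneg (hπ.nonneg hP z)]
    exact mul_le_mul_of_nonneg_left (ha.trans (hK z)) (hπ.nonneg hP z)
  have hKsum := hπ.hasSum_one.summable.mul_right K
  have hlim : Tendsto (fun t => ∑' z, π z * slope (fun t => P t z y) 0 t) (𝓝[>] 0)
      (𝓝 (∑' z, π z * generator q z y)) :=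
    tendsto_tsum_of_dominated_convergence hKsum
      (fun z => (hP.tendsto_slope z y).const_mul (π z))
      (eventually_mem_nhdsWithin.mono fun t ht z => hbound z _ (hP.norm_slope_le ht z y))
  have hzero : ∀ᶠ t in 𝓝[>] (0 : ℝ), ∑' z, π z * slope (fun t => P t z y) 0 t = 0 :=
    eventually_mem_nhdsWithin.mono fun t ht => (hπ.hasSum_mul_slope hP (le_of_lt ht) y).tsum_eq
  rw [← tendsto_nhds_unique_of_eventuallyEq hlim tendsto_const_nhds hzero]
  exact (hKsum.of_norm_bounded fun z => hbound z _ (hP.norm_generator_le z y)).hasSum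

lemma isPositiveSteadyState (hπ : IsLimitingDistribution P π) (hP : IsTransitionFunction q P)
    (hirr : ∀ x y, ∃ t, 0 ≤ t ∧ 0 < P t x y) (hself : ∀ x, q x x = 0) {K : ℝ}
    (hK : ∀ x, ∑' y, q x y ≤ K) : IsPositiveSteadyState q π where
  pos := hπ.pos hP hirr
  hasSum_one := hπ.hasSum_one
  balance y := by
    classical
    have h := (hπ.hasSum_mul_generator hP hK y).add (hasSum_ite_eq y (π y * ∑' w, q y w))
    rw [zero_add] at h
    refine h.congr_fun fun z => ?_
    by_cases hzy : z = y
    · subst hzy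
      simp [generator, hself]
    · simp [generator, hzy]

end IsLimitingDistribution

end Chain

noncomputable section BinomialSums

variable {K : ℕ} {r : ℝ} {d : ℕ → ℝ}

lemma hasSum_multichoose_mul_geometric (hr : ‖r‖ < 1) (k : ℕ) :
    HasSum (fun n : ℕ => (n.multichoose (k + 1) : ℝ) * r ^ n) (r / (1 - r) ^ (k + 2)) := by
  have h := (hasSum_choose_mul_geometric_of_norm_lt_one (k + 1) hr).mul_left r
  rw [mul_one_div] at h
  rw [← hasSum_nat_add_iff' 1]
  simp only [Finset.sum_range_one, Nat.multichoose_zero_succ, Nat.cast_zero, zero_mul, sub_zero]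
  refine h.congr_fun fun n => ?_
  rw [Nat.multichoose_eq, show n + 1 + (k + 1) - 1 = n + (k + 1) by omega]
  ring

/-- The combination `∑ k < K, d k * binom (n - 1 + k) k`, with the convention `binom (-1) 0 = 1`
built into `Nat.multichoose`. -/
def binomSum (K : ℕ) (d : ℕ → ℝ) (n : ℕ) : ℝ := ∑ k ∈ Finset.range K, d k * n.multichoose k

lemma binomSum_one (K : ℕ) (d : ℕ → ℝ) : binomSum K d 1 = ∑ k ∈ Finset.range K, d k := by
  simp [binomSum, Nat.multichoose_one]

lemma binomSum_zero (hd : ∀ k, K ≤ k → d k = 0) : binomSum K d 0 = d 0 := by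
  cases K with
  | zero => simp [binomSum, hd 0 le_rfl]
  | succ K => simp [binomSum, Finset.sum_range_succ']

lemma binomSum_of_le {L : ℕ} (hKL : K ≤ L) (hd : ∀ k, K ≤ k → d k = 0) (n : ℕ) :
    binomSum L d n = binomSum K d n :=
  (Finset.sum_subset (Finset.range_subset_range.2 hKL) fun k _ hk => by
    rw [hd k (by simpa using hk), zero_mul]).symm

lemma binomSum_sum {ι : Type*} (s : Finset ι) (d : ι → ℕ → ℝ) (n : ℕ) :
    binomSum K (fun k => ∑ i ∈ s, d i k) n = ∑ i ∈ s, binomSum K (d i) n := by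
  simp only [binomSum, Finset.sum_mul]
  exact Finset.sum_comm

lemma binomSum_succ_eq (K : ℕ) (d : ℕ → ℝ) (n : ℕ) :
    binomSum (K + 1) d n
      = binomSum K (fun k => d k - d (k + 1)) (n + 1) + d K * (n + 1).multichoose K := by
  induction K with
  | zero => simp [binomSum]
  | succ K ih =>
    rw [binomSum, Finset.sum_range_succ, ← binomSum, ih]
    simp only [binomSum, Finset.sum_range_succ, Nat.multichoose_succ_succ]
    push_cast
    ring

lemma binomSum_pred (hd : d K = 0) (n : ℕ) :
    binomSum K d n = binomSum K (fun k => d k - d (k + 1)) (n + 1) := by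
  have h := binomSum_succ_eq K d n
  rwa [binomSum, Finset.sum_range_succ, ← binomSum, hd, zero_mul, zero_mul, add_zero,
    add_zero] at h

lemma binomSum_pred_pred (hd : d K = 0) (hd' : d (K + 1) = 0) (n : ℕ) :
    binomSum K d n = binomSum K (fun k => d k - 2 * d (k + 1) + d (k + 2)) (n + 2) := by
  rw [binomSum_pred hd, binomSum_pred (by rw [hd, hd', sub_zero])]
  congr 1
  funext k
  ring

lemma hasSum_binomSum (hr : ‖r‖ < 1) (hK : 0 < K) (d : ℕ → ℝ) :
    HasSum (fun n => binomSum K d n * r ^ n)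
      (d 0 / (1 - r) + ∑ k ∈ Finset.Ico 1 K, d k * r / (1 - r) ^ (k + 1)) := by
  have hpos : HasSum (fun n : ℕ => ∑ k ∈ Finset.Ico 1 K, d k * (n.multichoose k * r ^ n))
      (∑ k ∈ Finset.Ico 1 K, d k * r / (1 - r) ^ (k + 1)) := by
    refine hasSum_sum fun k hk => ?_
    obtain ⟨k, rfl⟩ := Nat.exists_eq_add_of_le' (Finset.mem_Ico.1 hk).1
    rw [mul_div_assoc]
    exact (hasSum_multichoose_mul_geometric hr k).mul_left _
  refine (((hasSum_geometric_of_norm_lt_one hr).mul_left (d 0)).add hpos).congr_fun fun n => ?_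
  rw [binomSum, Finset.range_eq_Ico, Finset.sum_eq_sum_Ico_succ_bot hK, zero_add, add_mul,
    Finset.sum_mul, Nat.multichoose_zero_right, Nat.cast_one, mul_one]
  simp only [mul_assoc]

lemma tendsto_binomSum (hr : ‖r‖ < 1) (K : ℕ) (d : ℕ → ℝ) :
    Tendsto (fun n => binomSum K d n * r ^ n) atTop (𝓝 0) := by
  rcases K.eq_zero_or_pos with rfl | hK
  · simp [binomSum]
  · exact (hasSum_binomSum hr hK d).summable.tendsto_atTop_zero

/-- The solution, finitely supported with `d`, of `a * x k - x (k + 1) = d k`. -/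
def shiftResolvent (K : ℕ) (a : ℝ) (d : ℕ → ℝ) (k : ℕ) : ℝ :=
  ∑ u ∈ Finset.Ico k K, d u / a ^ (u + 1 - k)

lemma shiftResolvent_of_le {k : ℕ} (h : K ≤ k) (a : ℝ) (d : ℕ → ℝ) :
    shiftResolvent K a d k = 0 := by
  rw [shiftResolvent, Finset.Ico_eq_empty_of_le h, Finset.sum_empty]

lemma shiftResolvent_succ {a : ℝ} (ha : a ≠ 0) (hd : ∀ k, K ≤ k → d k = 0) (k : ℕ) :
    shiftResolvent K a d (k + 1) = a * shiftResolvent K a d k - d k := by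
  rcases lt_or_ge k K with h | h
  · rw [shiftResolvent, shiftResolvent, Finset.sum_eq_sum_Ico_succ_bot h, Nat.add_sub_cancel_left,
      pow_one, mul_add, mul_div_cancel₀ _ ha, add_sub_cancel_left, Finset.mul_sum]
    refine Finset.sum_congr rfl fun u hu => ?_
    rw [show u + 1 - k = u + 1 - (k + 1) + 1 by have := (Finset.mem_Ico.1 hu).1; omega, pow_succ]
    field_simp
  · rw [shiftResolvent_of_le h, shiftResolvent_of_le (by omega), hd k h, mul_zero, sub_zero]

lemma sum_range_mul_eq_sum_Ico {m u : ℕ} {F : ℕ → ℝ} (hF : ∀ i < m, i < u → F i = 0)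
    (G : ℕ → ℝ) : ∑ i ∈ Finset.range m, F i * G i = ∑ i ∈ Finset.Ico u m, F i * G i := by
  refine (Finset.sum_subset (fun i hi => ?_) fun i hi hiu => ?_).symm
  · exact Finset.mem_range.2 (Finset.mem_Ico.1 hi).2
  · simp only [Finset.mem_range, Finset.mem_Ico] at hi hiu
    rw [hF i hi (by omega), zero_mul]

lemma sum_shiftResolvent_mul {m : ℕ} {c : ℕ → ℕ → ℝ} (hc : ∀ i < m, ∀ u, i < u → c i u = 0)
    (a : ℝ) (w : ℕ → ℝ) (k : ℕ) :
    ∑ i ∈ Finset.range m, shiftResolvent m a (c i) k * w i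
      = ∑ u ∈ Finset.Ico k m, ∑ i ∈ Finset.Ico u m, c i u * (w i / a ^ (u + 1 - k)) := by
  simp only [shiftResolvent, Finset.sum_mul]
  rw [Finset.sum_comm]
  refine Finset.sum_congr rfl fun u _ => ?_
  rw [← sum_range_mul_eq_sum_Ico fun i hi hiu => hc i hi u hiu]
  exact Finset.sum_congr rfl fun i _ => mul_comm_div _ _ _

end BinomialSums

noncomputable section PhaseRecurrence

variable {ι : Type*} {s : Finset ι} {K : ℕ} {A B D T lam mu f g r : ℝ} {a b d : ℕ → ℝ}

/-- The operator `b ↦ A b_{n+2} + B b_{n+1} + D b_n`.  The flow into level `n + 1` of a phase from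
another one is of this form, with the rates `A`, `B`, `D` of the level changes `-1`, `0`, `1`. -/
def threeTerm (A B D : ℝ) (b : ℕ → ℝ) (n : ℕ) : ℝ := A * b (n + 2) + B * b (n + 1) + D * b n

/-- The action of `threeTerm A B D` on the coefficients `d` of a solution with base `r`, see
`threeTerm_binomSum_mul_pow`. -/
def threeTermSymbol (A B D r : ℝ) (d : ℕ → ℝ) (k : ℕ) : ℝ :=
  A * r * d k + B * (d k - d (k + 1)) + D / r * (d k - 2 * d (k + 1) + d (k + 2))

lemma threeTerm_binomSum_mul_pow (hr : r ≠ 0) (hd : d K = 0) (hd' : d (K + 1) = 0)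
    (A B D : ℝ) (n : ℕ) :
    threeTerm A B D (fun n => binomSum K d n * r ^ n) n
      = r ^ (n + 1) * binomSum K (threeTermSymbol A B D r d) (n + 2) := by
  rw [threeTerm, binomSum_pred hd (n + 1), binomSum_pred_pred hd hd' n]
  simp only [binomSum, threeTermSymbol, Finset.sum_mul, Finset.mul_sum, ← Finset.sum_add_distrib]
  refine Finset.sum_congr rfl fun k _ => ?_
  field_simp
  ring

-- Factoring the recurrence as `(E - s) (E - r) d = 0` with `E` the shift, `(E - r) d` is a multiple
-- of `s ^ n`, hence vanishes because it tends to `0`.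
lemma eq_zero_of_recurrence_of_tendsto_zero {s : ℝ} (hs : 1 ≤ s)
    (h : ∀ n, d (n + 2) = (r + s) * d (n + 1) - r * s * d n) (h0 : d 0 = 0)
    (hlim : Tendsto d atTop (𝓝 0)) (n : ℕ) : d n = 0 := by
  have hgeom : ∀ n, d (n + 1) - r * d n = s ^ n * d 1 := fun n => by
    induction n with
    | zero => simp [h0]
    | succ n ih => rw [pow_succ, mul_right_comm, ← ih, h]; ring
  have hlim' : Tendsto (fun n => s ^ n * d 1) atTop (𝓝 0) := by
    simpa only [hgeom, mul_zero, sub_zero, Function.comp_def] using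
      (hlim.comp (tendsto_add_atTop_nat 1)).sub (hlim.const_mul r)
  have h1 : d 1 = 0 := by
    refine abs_nonpos_iff.1 (abs_zero (α := ℝ) ▸ ge_of_tendsto' hlim'.abs fun n => ?_)
    rw [abs_mul]
    exact le_mul_of_one_le_left (abs_nonneg _) ((one_le_pow₀ hs).trans (le_abs_self _))
  induction n with
  | zero => exact h0
  | succ n ih => simpa only [ih, h1, mul_zero, sub_zero] using hgeom n

/-- The characteristic polynomial `mu * x ^ 2 - T * x + lam` of a phase with up rate `lam`, down
rate `mu` and exit rate `T` has the roots `r` and `1 / f`, which are separated by `1`. -/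
structure PhaseRoots (T lam mu r f : ℝ) : Prop where
  lam_pos : 0 < lam
  f_pos : 0 < f
  f_le_one : f ≤ 1
  r_pos : 0 < r
  r_lt_one : r < 1
  mu_eq : mu = lam * f / r
  total_eq : T = lam * f + lam / r

namespace PhaseRoots

lemma norm_lt_one (h : PhaseRoots T lam mu r f) : ‖r‖ < 1 := by
  rw [Real.norm_of_nonneg h.r_pos.le]
  exact h.r_lt_one

lemma one_sub_mul_ne_zero (h : PhaseRoots T lam mu r f) {x : ℝ} (hx : x ≤ 1) : 1 - r * x ≠ 0 :=
  (sub_pos.2 (mul_lt_one_of_nonneg_of_lt_one_left h.r_pos.le h.r_lt_one hx)).ne'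

lemma eq_of_threeTerm_eq (h : PhaseRoots T lam mu r f)
    (hab : ∀ n, threeTerm (-mu) T (-lam) a n = threeTerm (-mu) T (-lam) b n) (h0 : a 0 = b 0)
    (ha : Tendsto a atTop (𝓝 0)) (hb : Tendsto b atTop (𝓝 0)) (n : ℕ) : a n = b n := by
  refine sub_eq_zero.1 (eq_zero_of_recurrence_of_tendsto_zero (d := fun n => a n - b n) (r := r)
    (one_le_one_div h.f_pos h.f_le_one) (fun n => ?_) (sub_eq_zero.2 h0)
    (by simpa only [sub_zero] using ha.sub hb) n)
  have hn := hab n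
  have hl := h.lam_pos.ne'
  have hf := h.f_pos.ne'
  have hr := h.r_pos.ne'
  rw [threeTerm, threeTerm, h.mu_eq, h.total_eq] at hn
  field_simp at hn ⊢
  linear_combination -hn

lemma threeTermSymbol_eq (h : PhaseRoots T lam mu r f) (d : ℕ → ℝ) (k : ℕ) :
    threeTermSymbol (-mu) T (-lam) r d k
      = lam / r * ((1 - r * f) * d (k + 1) - d (k + 2)) := by
  have hr := h.r_pos.ne'
  rw [threeTermSymbol, h.mu_eq, h.total_eq]
  field_simp
  ring

lemma threeTerm_pow (h : PhaseRoots T lam mu r f) (n : ℕ) :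
    threeTerm (-mu) T (-lam) (fun n => r ^ n) n = 0 := by
  have hr := h.r_pos.ne'
  rw [threeTerm, h.mu_eq, h.total_eq]
  field_simp
  ring

end PhaseRoots

/-- The polynomial `∑ Δ, α Δ * x ^ (Δ + 1)` of the rates `α Δ` of the level changes
`Δ ∈ {-1, 0, 1}`. -/
def stepPoly (α : ℤ → ℝ) (x : ℝ) : ℝ := α (-1) + α 0 * x + α 1 * x ^ 2

lemma sum_Icc_neg_one_one (F : ℤ → ℝ) :
    ∑ Δ ∈ Finset.Icc (-1 : ℤ) 1, F Δ = F (-1) + F 0 + F 1 := by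
  rw [show Finset.Icc (-1 : ℤ) 1 = {-1, 0, 1} from rfl, Finset.sum_insert (by decide),
    Finset.sum_pair (by decide), add_assoc]

lemma sum_mul_zpow_add_one (α : ℤ → ℝ) (x : ℝ) :
    ∑ Δ ∈ Finset.Icc (-1 : ℤ) 1, α Δ * x ^ (Δ + 1) = stepPoly α x := by
  rw [sum_Icc_neg_one_one, stepPoly]
  norm_num

lemma sum_mul_zpow_neg (hr : r ≠ 0) (α : ℤ → ℝ) :
    ∑ Δ ∈ Finset.Icc (-1 : ℤ) 1, α Δ * r ^ (-Δ) = r * stepPoly α r⁻¹ := by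
  rw [sum_Icc_neg_one_one, stepPoly, neg_neg, zpow_one, neg_zero, zpow_zero, zpow_neg_one]
  field_simp

lemma sum_mul_one_div_sub_one_div (α : ℤ → ℝ) (a b g : ℝ) :
    ∑ Δ ∈ Finset.Icc (-1 : ℤ) 1, α Δ * (1 / a - 1 / (g ^ (Δ + 1) * b))
      = stepPoly α 1 / a - stepPoly α g⁻¹ / b := by
  simp only [← sum_mul_zpow_add_one, Finset.sum_div, ← Finset.sum_sub_distrib, one_zpow, inv_zpow]
  exact Finset.sum_congr rfl fun Δ _ => by ring

/-- The contribution of a term with base `r` and coefficients `d` in a lower phase to the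
coefficients of a phase with the same base; `α Δ` are the rates of the transitions to that phase. -/
def sameBaseCoeff (K : ℕ) (lam r f : ℝ) (α : ℤ → ℝ) (d : ℕ → ℝ) (k : ℕ) : ℝ :=
  r / (lam * (1 - r * f)) * r
      * (shiftResolvent K (1 - r * f) d k * stepPoly α f + d (k - 1) * stepPoly α r⁻¹)
    - 1 / lam * (d k * α 1)

/-- The contribution of a term with base `r` and coefficients `d` in a lower phase to the
coefficients of base `r` of a phase with another base `g`. -/
def newBaseCoeff (K : ℕ) (lam r g f : ℝ) (α : ℤ → ℝ) (d : ℕ → ℝ) (k : ℕ) : ℝ :=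
  g / (lam * (1 - g * f)) * r
      * (shiftResolvent K (1 - r * f) d k * stepPoly α f
        - shiftResolvent K (1 - r / g) d k * stepPoly α g⁻¹)
    - 1 / lam * (d k * α 1)

lemma sameBaseCoeff_of_lt {α : ℤ → ℝ} (hd : ∀ k, K ≤ k → d k = 0) {k : ℕ} (hk : K < k) :
    sameBaseCoeff K lam r f α d k = 0 := by
  rw [sameBaseCoeff, shiftResolvent_of_le hk.le, hd k hk.le, hd (k - 1) (by omega)]
  ring

lemma newBaseCoeff_of_le {α : ℤ → ℝ} (hd : ∀ k, K ≤ k → d k = 0) {k : ℕ} (hk : K ≤ k) :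
    newBaseCoeff K lam r g f α d k = 0 := by
  rw [newBaseCoeff, shiftResolvent_of_le hk, shiftResolvent_of_le hk, hd k hk]
  ring

namespace PhaseRoots

lemma sameBaseCoeff_spec (h : PhaseRoots T lam mu r f) (hd : ∀ k, K ≤ k → d k = 0) (α : ℤ → ℝ)
    (k : ℕ) :
    threeTermSymbol (-mu) T (-lam) r (sameBaseCoeff K lam r f α d) k
      = threeTermSymbol (α (-1)) (α 0) (α 1) r d k := by
  have ha := h.one_sub_mul_ne_zero h.f_le_one
  have hr := h.r_pos.ne'
  have hl := h.lam_pos.ne'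
  rw [h.threeTermSymbol_eq]
  simp only [threeTermSymbol, sameBaseCoeff, stepPoly, Nat.add_sub_cancel,
    shiftResolvent_succ ha hd (k + 1), show k + 2 - 1 = k + 1 from rfl]
  field_simp
  ring

lemma newBaseCoeff_spec (h : PhaseRoots T lam mu g f) (hr : r ≠ 0) (hrf : 1 - r * f ≠ 0)
    (hrg : r ≠ g) (hd : ∀ k, K ≤ k → d k = 0) (α : ℤ → ℝ) (k : ℕ) :
    threeTermSymbol (-mu) T (-lam) r (newBaseCoeff K lam r g f α d) k
      = threeTermSymbol (α (-1)) (α 0) (α 1) r d k := by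
  have hg := h.r_pos.ne'
  have hgf : 1 - f * g ≠ 0 := mul_comm g f ▸ h.one_sub_mul_ne_zero h.f_le_one
  have hl := h.lam_pos.ne'
  have hb : 1 - r / g ≠ 0 := sub_ne_zero.2 fun e => hrg ((div_eq_one_iff_eq hg).1 e.symm)
  simp only [threeTermSymbol, newBaseCoeff, stepPoly, h.mu_eq, h.total_eq,
    shiftResolvent_succ hrf hd, shiftResolvent_succ hb hd]
  field_simp
  ring

end PhaseRoots

variable {α : ι → ℤ → ℝ} {e : ι → ℕ → ℝ}

lemma threeTermSymbol_sum (A B D : ℝ) (e : ι → ℕ → ℝ) (k : ℕ) :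
    threeTermSymbol A B D r (fun k => ∑ i ∈ s, e i k) k
      = ∑ i ∈ s, threeTermSymbol A B D r (e i) k := by
  simp only [threeTermSymbol, Finset.mul_sum, ← Finset.sum_sub_distrib, ← Finset.sum_add_distrib]

lemma sum_threeTerm_binomSum_mul_pow (hr : r ≠ 0) (he : ∀ i ∈ s, ∀ k, K ≤ k → e i k = 0)
    (n : ℕ) :
    ∑ i ∈ s, threeTerm (α i (-1)) (α i 0) (α i 1) (fun n => binomSum K (e i) n * r ^ n) n
      = r ^ (n + 1) * binomSum K
        (fun k => ∑ i ∈ s, threeTermSymbol (α i (-1)) (α i 0) (α i 1) r (e i) k) (n + 2) := by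
  rw [binomSum_sum, Finset.mul_sum]
  exact Finset.sum_congr rfl fun i hi =>
    threeTerm_binomSum_mul_pow hr (he i hi K le_rfl) (he i hi _ K.le_succ) _ _ _ n

namespace PhaseRoots

-- `x 0` is free, since the symbol at `k` involves only `x (k + 1)` and `x (k + 2)`.
lemma eq_binomSum_of_sameBase (h : PhaseRoots T lam mu r f) {x : ℕ → ℝ}
    (he : ∀ i ∈ s, ∀ k, K ≤ k → e i k = 0)
    (ha : ∀ n, threeTerm (-mu) T (-lam) a n = ∑ i ∈ s,
      threeTerm (α i (-1)) (α i 0) (α i 1) (fun n => binomSum K (e i) n * r ^ n) n)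
    (hlim : Tendsto a atTop (𝓝 0)) (hx0 : x 0 = a 0)
    (hx : ∀ k, x (k + 1) = ∑ i ∈ s, sameBaseCoeff K lam r f (α i) (e i) (k + 1)) (n : ℕ) :
    a n = binomSum (K + 1) x n * r ^ n := by
  have hxK : ∀ k, K + 1 ≤ k → x k = 0 := fun k hk => by
    obtain ⟨k, rfl⟩ := Nat.exists_eq_add_of_le' (Nat.one_le_of_lt hk)
    rw [hx]
    exact Finset.sum_eq_zero fun i hi => sameBaseCoeff_of_lt (he i hi) hk
  have hsymbol : ∀ k, threeTermSymbol (-mu) T (-lam) r x k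
      = ∑ i ∈ s, threeTermSymbol (α i (-1)) (α i 0) (α i 1) r (e i) k := fun k => by
    rw [h.threeTermSymbol_eq, hx, hx, ← h.threeTermSymbol_eq fun k => ∑ i ∈ s,
      sameBaseCoeff K lam r f (α i) (e i) k, threeTermSymbol_sum]
    exact Finset.sum_congr rfl fun i hi => h.sameBaseCoeff_spec (he i hi) (α i) k
  refine h.eq_of_threeTerm_eq (fun n => ?_) ?_ hlim (tendsto_binomSum h.norm_lt_one _ x) n
  · have he' : ∀ i ∈ s, ∀ k, K + 1 ≤ k → e i k = 0 := fun i hi k hk => he i hi k (by omega)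
    rw [ha, threeTerm_binomSum_mul_pow h.r_pos.ne' (hxK _ le_rfl) (hxK _ (Nat.le_succ _)),
      funext hsymbol, ← sum_threeTerm_binomSum_mul_pow h.r_pos.ne' he']
    refine Finset.sum_congr rfl fun i hi => ?_
    simp only [binomSum_of_le K.le_succ (he i hi)]
  · rw [binomSum_zero hxK, pow_zero, mul_one, hx0]

lemma eq_binomSum_of_newBase (h : PhaseRoots T lam mu g f) (hr : r ≠ 0) (hr1 : ‖r‖ < 1)
    (hrf : 1 - r * f ≠ 0) (hrg : r ≠ g) {x : ℕ → ℝ} (he : ∀ i ∈ s, ∀ k, K ≤ k → e i k = 0)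
    (ha : ∀ n, threeTerm (-mu) T (-lam) a n = ∑ i ∈ s,
      threeTerm (α i (-1)) (α i 0) (α i 1) (fun n => binomSum K (e i) n * r ^ n) n)
    (hlim : Tendsto a atTop (𝓝 0))
    (hx : ∀ k, x k = ∑ i ∈ s, newBaseCoeff K lam r g f (α i) (e i) k) (n : ℕ) :
    a n = binomSum K x n * r ^ n + (a 0 - x 0) * g ^ n := by
  have hxK : ∀ k, K ≤ k → x k = 0 := fun k hk => by
    rw [hx]
    exact Finset.sum_eq_zero fun i hi => newBaseCoeff_of_le (he i hi) hk
  have hsymbol : ∀ k, threeTermSymbol (-mu) T (-lam) r x k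
      = ∑ i ∈ s, threeTermSymbol (α i (-1)) (α i 0) (α i 1) r (e i) k := fun k => by
    rw [funext hx, threeTermSymbol_sum]
    exact Finset.sum_congr rfl fun i hi => h.newBaseCoeff_spec hr hrf hrg (he i hi) (α i) k
  refine h.eq_of_threeTerm_eq (b := fun n => binomSum K x n * r ^ n + (a 0 - x 0) * g ^ n)
    (fun n => ?_) ?_ hlim ?_ n
  · have hsplit : threeTerm (-mu) T (-lam)
          (fun n => binomSum K x n * r ^ n + (a 0 - x 0) * g ^ n) n
        = threeTerm (-mu) T (-lam) (fun n => binomSum K x n * r ^ n) n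
          + (a 0 - x 0) * threeTerm (-mu) T (-lam) (fun n => g ^ n) n := by
      simp only [threeTerm]
      ring
    rw [ha, hsplit, h.threeTerm_pow, mul_zero, add_zero, sum_threeTerm_binomSum_mul_pow hr he,
      threeTerm_binomSum_mul_pow hr (hxK _ le_rfl) (hxK _ (Nat.le_succ _)), funext hsymbol]
  · rw [binomSum_zero hxK]
    ring
  · simpa only [mul_zero, add_zero] using (tendsto_binomSum hr1 K x).add
      ((tendsto_pow_atTop_nhds_zero_of_norm_lt_one h.norm_lt_one).const_mul (a 0 - x 0))

end PhaseRoots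

-- The net upward flow `lam * a n - mu * a (n + 1)` is monotone and tends to `0`, so it is
-- nonpositive; if `mu ≤ lam` then `a` is monotone, which contradicts `a n → 0`.
lemma lt_of_supersolution_tendsto_zero (hlam : 0 < lam) (hpos : ∀ n, 0 < a n)
    (hsup : ∀ n, lam * a n + mu * a (n + 2) ≤ (lam + mu) * a (n + 1))
    (hlim : Tendsto a atTop (𝓝 0)) : lam < mu := by
  by_contra! hle
  have hmono : Monotone fun n => lam * a n - mu * a (n + 1) :=
    monotone_nat_of_le_succ fun n => by linarith only [hsup n]
  have hflow : Tendsto (fun n => lam * a n - mu * a (n + 1)) atTop (𝓝 0) := by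
    simpa only [mul_zero, sub_zero, Function.comp_def] using
      (hlim.const_mul lam).sub ((hlim.comp (tendsto_add_atTop_nat 1)).const_mul mu)
  have ha : Monotone a := monotone_nat_of_le_succ fun n =>
    le_of_mul_le_mul_left ((sub_nonpos.1 (hmono.ge_of_tendsto hflow n)).trans
      (mul_le_mul_of_nonneg_right hle (hpos _).le)) hlam
  exact (hpos 0).not_ge (ha.ge_of_tendsto hlim 0)

lemma phaseRoots_of_quadratic (hlam : 0 < lam) (hmu : 0 < mu) (hf : 0 < f) (hf1 : f ≤ 1)
    (hlt : lam * f < mu) (hroot : lam * f ^ 2 + mu = T * f) :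
    PhaseRoots T lam mu (lam / mu * f) f where
  lam_pos := hlam
  f_pos := hf
  f_le_one := hf1
  r_pos := by positivity
  r_lt_one := by rwa [div_mul_eq_mul_div, div_lt_one hmu]
  mu_eq := by field_simp
  total_eq := by
    field_simp
    linear_combination -hroot

lemma phaseRoots_of_busyPeriod {s : ℝ} (hlam : 0 < lam) (hmu : 0 < mu) (hs : 0 ≤ s)
    (hlt : s = 0 → lam < mu)
    (hf : f = (s + lam + mu - √((s + lam + mu) ^ 2 - 4 * lam * mu)) / (2 * lam)) :
    PhaseRoots (lam + mu + s) lam mu (lam / mu * f) f := by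
  set D := √((s + lam + mu) ^ 2 - 4 * lam * mu) with hD
  have hlam_sq : (s + lam + mu) ^ 2 - 4 * lam * mu = (s + mu - lam) ^ 2 + 4 * (s * lam) := by ring
  have hmu_sq : (s + lam + mu) ^ 2 - 4 * lam * mu = (s + lam - mu) ^ 2 + 4 * (s * mu) := by ring
  have hsq : D ^ 2 = (s + lam + mu) ^ 2 - 4 * lam * mu :=
    Real.sq_sqrt (hlam_sq ▸ by positivity)
  have hfD : 2 * lam * f = s + lam + mu - D := by
    rw [hf]
    field_simp
  have hD_lt : D < s + lam + mu :=
    (Real.sqrt_lt' (by positivity)).2 (sub_lt_self _ (by positivity))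
  have hD_ge : s + mu - lam ≤ D :=
    Real.le_sqrt_of_sq_le (hlam_sq ▸ le_add_of_nonneg_right (by positivity))
  have hD_gt : s + lam - mu < D := by
    rcases hs.eq_or_lt with rfl | hs
    · linarith only [hlt rfl, hD_ge]
    · exact Real.lt_sqrt_of_sq_lt (hmu_sq ▸ lt_add_of_pos_right _ (by positivity))
  have hf0 : 0 < f := hf ▸ div_pos (sub_pos.2 hD_lt) (by positivity)
  refine phaseRoots_of_quadratic hlam hmu hf0 ?_ (by linarith only [hfD, hD_gt]) ?_
  · exact le_of_mul_le_mul_left (by linarith only [hfD, hD_ge]) (mul_pos two_pos hlam)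
  · rw [show D = s + lam + mu - 2 * lam * f by linarith only [hfD]] at hsq
    exact mul_left_cancel₀ (mul_pos four_pos hlam).ne' (by linear_combination hsq)

end PhaseRecurrence

namespace MState

variable {N : Type*} {M j₀ : ℕ} {f : MState N M j₀ → ℝ}

/-- The state of phase `m` at height `n` above the lowest level `j₀` of the repeating portion. -/
abbrev lvl (m : Fin (M + 1)) (n : ℕ) : MState N M j₀ := rep m (j₀ + n) (Nat.le_add_right j₀ n)

lemma rep_eq_lvl (m : Fin (M + 1)) (j : ℕ) (hj : j₀ ≤ j) :
    (rep m j hj : MState N M j₀) = lvl m (j - j₀) := by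
  simp only [lvl, Nat.add_sub_of_le hj]

lemma lvl_injective (m : Fin (M + 1)) : Function.Injective (lvl m : ℕ → MState N M j₀) :=
  fun n l h => by simpa using h

lemma forall_iff {p : MState N M j₀ → Prop} :
    (∀ z, p z) ↔ (∀ x, p (non x)) ∧ ∀ m n, p (lvl m n) := by
  refine ⟨fun h => ⟨fun x => h _, fun m n => h _⟩, fun ⟨hN, hR⟩ => ?_⟩
  rintro (x | ⟨m, j, hj⟩)
  · exact hN x
  · exact (congrArg p (rep_eq_lvl m j hj)).mpr (hR m _)

lemma hasSum_of_hasSum_lvl {a : ℝ} {b : Fin (M + 1) → ℝ} (hN : HasSum (fun x => f (non x)) a)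
    (hR : ∀ m, HasSum (fun n => f (lvl m n)) (b m)) : HasSum f (a + ∑ m, b m) := by
  have hphase : ∀ m, HasSum ((Set.range (lvl m)).indicator f) (b m) := fun m =>
    hasSum_subtype_iff_indicator.1 ((lvl_injective m).hasSum_range_iff.2 (hR m))
  have hnon : HasSum ((Set.range non).indicator f) a :=
    hasSum_subtype_iff_indicator.1 (Sum.inl_injective.hasSum_range_iff.2 hN)
  refine (hnon.add (hasSum_sum fun m _ => hphase m)).congr_fun
    (forall_iff.2 ⟨fun x => by simp, fun m n => ?_⟩)
  rw [Finset.sum_eq_single_of_mem m (Finset.mem_univ m) fun i _ hi => by simp [hi]]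
  simp

lemma hasSum_of_window {l : ℕ} (hN : ∀ x, f (non x) = 0)
    (hR : ∀ m n, n < l ∨ l + 2 < n → f (lvl m n) = 0) :
    HasSum f (∑ m, (f (lvl m l) + f (lvl m (l + 1)) + f (lvl m (l + 2)))) := by
  rw [← zero_add (∑ m, _)]
  refine hasSum_of_hasSum_lvl (by simp only [hN, hasSum_zero]) fun m => ?_
  rw [add_assoc, ← Finset.sum_pair (f := fun n => f (lvl m n)) (by simp),
    ← Finset.sum_insert (f := fun n => f (lvl m n)) (by simp)]
  refine hasSum_sum_of_ne_finset_zero fun n hn => hR m n ?_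
  simp only [Finset.mem_insert, Finset.mem_singleton] at hn
  omega

lemma hasSum_of_boundary [Fintype N] (hR : ∀ m n, 1 < n → f (lvl m n) = 0) :
    HasSum f (∑ x, f (non x) + ∑ m, (f (lvl m 0) + f (lvl m 1))) := by
  refine hasSum_of_hasSum_lvl (hasSum_fintype _) fun m => ?_
  rw [← Finset.sum_pair (f := fun n => f (lvl m n)) zero_ne_one]
  refine hasSum_sum_of_ne_finset_zero fun n hn => hR m n ?_
  simp only [Finset.mem_insert, Finset.mem_singleton] at hn
  omega

end MState

section PhaseSums

variable {M : ℕ} {F : Fin (M + 1) → ℝ} (m : Fin (M + 1))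

lemma sum_eq_add_sum_Icc (G : ℕ → ℝ) (h0 : ∀ i < m, F i = 0) (hG : ∀ i, m < i → F i = G i) :
    ∑ i, F i = F m + ∑ i ∈ Finset.Icc ((m : ℕ) + 1) M, G i := by
  have hval : Finset.Icc ((m : ℕ) + 1) M = (Finset.Ioi m).map Fin.valEmbedding := by
    rw [Fin.map_valEmbedding_Ioi]
    ext i
    simp only [Finset.mem_Icc, Finset.mem_Ioo]
    omega
  have hzero : ∀ i ∈ Finset.univ, i ∉ Finset.Ici m → F i = 0 := fun i _ hi =>
    h0 i (by simpa using hi)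
  rw [← Finset.sum_subset (Finset.subset_univ _) hzero, ← Finset.Ioi_insert,
    Finset.sum_insert (by simp), hval, Finset.sum_map]
  congr 1
  exact Finset.sum_congr rfl fun i hi => hG i (by simpa using hi)

lemma sum_eq_add_sum_Iio (h0 : ∀ i, m < i → F i = 0) :
    ∑ i, F i = F m + ∑ i ∈ Finset.Iio m, F i := by
  have hzero : ∀ i ∈ Finset.univ, i ∉ Finset.Iic m → F i = 0 := fun i _ hi =>
    h0 i (by simpa using hi)
  rw [← Finset.sum_subset (Finset.subset_univ _) hzero, ← Finset.Iio_insert,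
    Finset.sum_insert (by simp)]

lemma sum_Iio_eq_sum_range (G : ℕ → ℝ) :
    ∑ i ∈ Finset.Iio m, G i = ∑ i ∈ Finset.range m, G i := by
  rw [← Nat.Iio_eq_range, ← Fin.map_valEmbedding_Iio, Finset.sum_map]
  rfl

lemma sum_Icc_zero_one (F : ℤ → ℝ) : ∑ Δ ∈ Finset.Icc (0 : ℤ) 1, F Δ = F 0 + F 1 := by
  rw [show Finset.Icc (0 : ℤ) 1 = {0, 1} from rfl, Finset.sum_pair zero_ne_one]

end PhaseSums

namespace ClassM

variable {N : Type*} {M j₀ : ℕ} (C : ClassM N M j₀)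

section Rates

lemma alp_nonneg {m i : ℕ} (hmi : m < i) (hi : i ≤ M) {Δ : ℤ} (hΔ : Δ ∈ Finset.Icc (-1) 1) :
    0 ≤ C.alp m (i - m) Δ := by
  have h : (⟨m, by omega⟩ : Fin (M + 1)) < ⟨i, by omega⟩ := hmi
  obtain rfl | rfl | rfl : Δ = -1 ∨ Δ = 0 ∨ Δ = 1 := by
    rw [Finset.mem_Icc] at hΔ
    omega
  · exact (C.q_up_left _ _ h j₀ le_rfl).symm ▸ C.q_nonneg _ _
  · exact (C.q_up_stay _ _ h j₀ le_rfl).symm ▸ C.q_nonneg _ _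
  · exact (C.q_up_right _ _ h j₀ le_rfl).symm ▸ C.q_nonneg _ _

lemma alpha_nonneg {m : ℕ} : 0 ≤ C.alpha m :=
  Finset.sum_nonneg fun _ hi => Finset.sum_nonneg fun _ hΔ =>
    C.alp_nonneg (Nat.lt_of_succ_le (Finset.mem_Icc.1 hi).1) (Finset.mem_Icc.1 hi).2 hΔ

lemma alpha_last : C.alpha M = 0 := by
  rw [alpha, Finset.Icc_eq_empty (by omega), Finset.sum_empty]

lemma q_lvl_up_left {m i : Fin (M + 1)} (h : m < i) (n : ℕ) :
    C.q (MState.lvl m (n + 1)) (MState.lvl i n) = C.alp m (i - m) (-1) :=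
  C.q_up_left m i h (j₀ + n) (Nat.le_add_right _ _)

lemma q_lvl_up_stay {m i : Fin (M + 1)} (h : m < i) (n : ℕ) :
    C.q (MState.lvl m n) (MState.lvl i n) = C.alp m (i - m) 0 :=
  C.q_up_stay m i h (j₀ + n) (Nat.le_add_right _ _)

lemma q_lvl_up_right {m i : Fin (M + 1)} (h : m < i) (n : ℕ) :
    C.q (MState.lvl m n) (MState.lvl i (n + 1)) = C.alp m (i - m) 1 :=
  C.q_up_right m i h (j₀ + n) (Nat.le_add_right _ _)

lemma q_lvl_left (m : Fin (M + 1)) (n : ℕ) :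
    C.q (MState.lvl m (n + 1)) (MState.lvl m n) = C.mu m :=
  C.q_left m (j₀ + n) (Nat.le_add_right _ _)

lemma q_lvl_right (m : Fin (M + 1)) (n : ℕ) :
    C.q (MState.lvl m n) (MState.lvl m (n + 1)) = C.lam m :=
  C.q_right m (j₀ + n) (Nat.le_add_right _ _)

lemma q_lvl_of_lt {m i : Fin (M + 1)} (h : i < m) (n l : ℕ) :
    C.q (MState.lvl m n) (MState.lvl i l) = 0 :=
  C.q_unidirectional m i h _ _ _ _

lemma q_lvl_skip (m i : Fin (M + 1)) {n l : ℕ} (h : n + 1 < l ∨ l + 1 < n) :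
    C.q (MState.lvl m n) (MState.lvl i l) = 0 :=
  C.q_skip_free m i _ _ _ _ (by omega)

lemma q_lvl_non (m : Fin (M + 1)) (n : ℕ) (x : N) :
    C.q (MState.lvl m (n + 1)) (MState.non x) = 0 :=
  C.q_rep_non x m _ _ (by omega)

lemma q_non_lvl (x : N) (m : Fin (M + 1)) (n : ℕ) :
    C.q (MState.non x) (MState.lvl m (n + 1)) = 0 :=
  C.q_non_rep x m _ _ (by omega)

end Rates

section Outflow

lemma hasSum_out_succ (m : Fin (M + 1)) (l : ℕ) :
    HasSum (C.q (MState.lvl m (l + 1))) (C.lam m + C.mu m + C.alpha m) := by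
  convert MState.hasSum_of_window (l := l) (C.q_lvl_non m l)
    fun i n h => C.q_lvl_skip m i (by omega) using 1
  rw [sum_eq_add_sum_Icc m (fun i => ∑ Δ ∈ Finset.Icc (-1 : ℤ) 1, C.alp m (i - m) Δ)
    (fun i hi => by simp only [C.q_lvl_of_lt hi, add_zero])
    fun i hi => by rw [sum_Icc_neg_one_one, C.q_lvl_up_left hi, C.q_lvl_up_stay hi,
      C.q_lvl_up_right hi], C.q_lvl_left, C.q_lvl_right, C.q_self, alpha]
  ring

lemma hasSum_out_zero [Fintype N] (m : Fin (M + 1)) :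
    HasSum (C.q (MState.lvl m 0)) (C.lam m
      + (∑ i ∈ Finset.Icc ((m : ℕ) + 1) M, ∑ Δ ∈ Finset.Icc (0 : ℤ) 1, C.alp m (i - m) Δ)
      + ∑ x : N, C.q (MState.lvl m 0) (MState.non x)) := by
  convert MState.hasSum_of_boundary (f := C.q (MState.lvl m 0))
    fun i n h => C.q_lvl_skip m i (by omega) using 1
  rw [sum_eq_add_sum_Icc m (fun i => ∑ Δ ∈ Finset.Icc (0 : ℤ) 1, C.alp m (i - m) Δ)
    (fun i hi => by simp only [C.q_lvl_of_lt hi, add_zero])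
    fun i hi => by rw [sum_Icc_zero_one, C.q_lvl_up_stay hi, C.q_lvl_up_right hi],
    C.q_lvl_right, C.q_self]
  ring

lemma hasSum_out_non [Fintype N] (x : N) :
    HasSum (C.q (MState.non x)) ((∑ m, C.q (MState.non x) (MState.lvl m 0))
      + ∑ y, C.q (MState.non x) (MState.non y)) := by
  convert MState.hasSum_of_boundary (f := C.q (MState.non x)) fun i n h => ?_ using 1
  · simp only [C.q_non_lvl, add_zero]
    exact add_comm _ _
  · obtain ⟨n, rfl⟩ := Nat.exists_eq_add_of_le' h.le
    exact C.q_non_lvl x i n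

lemma exists_exit_rate_le [Finite N] : ∃ K, ∀ z, ∑' y, C.q z y ≤ K := by
  let rate := fun z => ∑' y, C.q z y
  obtain ⟨K, hK⟩ := ((Set.finite_range (rate ∘ MState.non)).union <|
    (Set.finite_range fun m => rate (MState.lvl m 0)).union <|
    Set.finite_range fun m : Fin (M + 1) => C.lam m + C.mu m + C.alpha m).bddAbove
  refine ⟨K, MState.forall_iff.2 ⟨fun x => hK (.inl ⟨x, rfl⟩), fun m n => ?_⟩⟩
  cases n with
  | zero => exact hK (.inr (.inl ⟨m, rfl⟩))
  | succ n => exact (C.hasSum_out_succ m n).tsum_eq ▸ hK (.inr (.inr ⟨m, rfl⟩))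

end Outflow

section Inflow

variable (π : MState N M j₀ → ℝ)

lemma hasSum_in_succ (m : Fin (M + 1)) (l : ℕ) :
    HasSum (fun z => π z * C.q z (MState.lvl m (l + 1)))
      (C.lam m * π (MState.lvl m l) + C.mu m * π (MState.lvl m (l + 2))
        + ∑ i ∈ Finset.Iio m, (C.alp i (m - i) (-1) * π (MState.lvl i (l + 2))
          + C.alp i (m - i) 0 * π (MState.lvl i (l + 1))
          + C.alp i (m - i) 1 * π (MState.lvl i l))) := by
  convert MState.hasSum_of_window (l := l) (f := fun z => π z * C.q z (MState.lvl m (l + 1)))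
    (fun x => by rw [C.q_non_lvl, mul_zero])
    (fun i n h => by rw [C.q_lvl_skip i m (by omega), mul_zero]) using 1
  rw [sum_eq_add_sum_Iio m fun i hi => by simp only [C.q_lvl_of_lt hi, mul_zero, add_zero],
    C.q_lvl_left, C.q_lvl_right, C.q_self]
  congr 1
  · ring
  · refine Finset.sum_congr rfl fun i hi => ?_
    have hi := Finset.mem_Iio.1 hi
    rw [C.q_lvl_up_left hi, C.q_lvl_up_stay hi, C.q_lvl_up_right hi]
    ring

variable [Fintype N]

lemma hasSum_in_zero (m : Fin (M + 1)) :
    HasSum (fun z => π z * C.q z (MState.lvl m 0))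
      (C.mu m * π (MState.lvl m 1)
        + (∑ x, C.q (MState.non x) (MState.lvl m 0) * π (MState.non x))
        + ∑ i ∈ Finset.Iio m, (C.alp i (m - i) 0 * π (MState.lvl i 0)
          + C.alp i (m - i) (-1) * π (MState.lvl i 1))) := by
  convert MState.hasSum_of_boundary (f := fun z => π z * C.q z (MState.lvl m 0))
    (fun i n h => by rw [C.q_lvl_skip i m (by omega), mul_zero]) using 1
  rw [sum_eq_add_sum_Iio m fun i hi => by simp only [C.q_lvl_of_lt hi, mul_zero, add_zero],
    C.q_lvl_left, C.q_self, ← add_assoc]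
  congr 1
  · simp only [mul_comm (π _), zero_mul, zero_add, add_comm]
  · refine Finset.sum_congr rfl fun i hi => ?_
    have hi := Finset.mem_Iio.1 hi
    rw [C.q_lvl_up_left hi, C.q_lvl_up_stay hi]
    ring

lemma hasSum_in_non (x : N) :
    HasSum (fun z => π z * C.q z (MState.non x))
      ((∑ m, C.q (MState.lvl m 0) (MState.non x) * π (MState.lvl m 0))
        + ∑ y, C.q (MState.non y) (MState.non x) * π (MState.non y)) := by
  convert MState.hasSum_of_boundary (f := fun z => π z * C.q z (MState.non x))
    (fun i n h => ?_) using 1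
  · simp only [C.q_lvl_non, mul_zero, add_zero]
    rw [add_comm]
    simp only [mul_comm (π _)]
  · obtain ⟨n, rfl⟩ := Nat.exists_eq_add_of_le' h.le
    rw [C.q_lvl_non, mul_zero]

end Inflow

end ClassM

noncomputable section LevelProb

namespace MState

variable {N : Type*} {M j₀ : ℕ}

/-- The value of `π` at the state of phase `m` and height `n` above the level `j₀`, with the phase a
natural number; for `m > M`, the phase is reduced modulo `M + 1`. -/
def levelProb (π : MState N M j₀ → ℝ) (m n : ℕ) : ℝ := π (lvl (Fin.ofNat (M + 1) m) n)

variable {π : MState N M j₀ → ℝ}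

lemma levelProb_val (m : Fin (M + 1)) (n : ℕ) : levelProb π m n = π (lvl m n) := by
  rw [levelProb, Fin.ofNat_val_eq_self]

lemma summable_levelProb (hπ : Summable π) (m : ℕ) : Summable (levelProb π m) :=
  hπ.comp_injective (lvl_injective _)

lemma sum_add_sum_tsum_levelProb [Fintype N] {a : ℝ} (hπ : HasSum π a) :
    ∑ x, π (non x) + ∑ m ∈ Finset.range M, ∑' n, levelProb π m n + ∑' n, levelProb π M n = a := by
  rw [add_assoc, ← Finset.sum_range_succ, ← Fin.sum_univ_eq_sum_range fun m =>
    ∑' n, levelProb π m n]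
  refine (hasSum_of_hasSum_lvl (hasSum_fintype _) fun m => ?_).unique hπ
  simp only [← levelProb_val]
  exact (summable_levelProb hπ.summable m).hasSum

end MState

namespace ClassM

open MState

variable {N : Type*} {M j₀ : ℕ} {C : ClassM N M j₀} {π : MState N M j₀ → ℝ} {m : ℕ}

lemma threeTerm_levelProb (hπ : IsPositiveSteadyState C.q π) (hm : m ≤ M) (n : ℕ) :
    threeTerm (-C.mu m) (C.lam m + C.mu m + C.alpha m) (-C.lam m) (levelProb π m) n
      = ∑ i ∈ Finset.range m, threeTerm (C.alp i (m - i) (-1)) (C.alp i (m - i) 0)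
          (C.alp i (m - i) 1) (levelProb π i) n := by
  lift m to Fin (M + 1) using Nat.lt_succ_of_le hm
  have hbal := (hπ.balance (lvl m (n + 1))).unique (C.hasSum_in_succ π m n)
  rw [(C.hasSum_out_succ m n).tsum_eq] at hbal
  simp only [threeTerm, levelProb_val, ← sum_Iio_eq_sum_range m]
  linear_combination hbal

lemma sum_threeTerm_levelProb_nonneg (hπ : ∀ z, 0 ≤ π z) (hm : m ≤ M) (n : ℕ) :
    0 ≤ ∑ i ∈ Finset.range m, threeTerm (C.alp i (m - i) (-1)) (C.alp i (m - i) 0)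
      (C.alp i (m - i) 1) (levelProb π i) n :=
  Finset.sum_nonneg fun i hi => by
    have halp := fun Δ => C.alp_nonneg (Finset.mem_range.1 hi) hm (Δ := Δ)
    exact add_nonneg (add_nonneg (mul_nonneg (halp _ (by decide)) (hπ _))
      (mul_nonneg (halp _ (by decide)) (hπ _))) (mul_nonneg (halp _ (by decide)) (hπ _))

lemma lam_lt_mu (hπ : IsPositiveSteadyState C.q π) (hm : m ≤ M) (hlam : 0 < C.lam m)
    (hα : C.alpha m = 0) : C.lam m < C.mu m := by
  refine lt_of_supersolution_tendsto_zero (a := levelProb π m) hlam (fun n => hπ.pos _)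
    (fun n => ?_) (summable_levelProb hπ.hasSum_one.summable m).tendsto_atTop_zero
  have hin := sum_threeTerm_levelProb_nonneg (C := C) (fun z => (hπ.pos z).le) hm n
  rw [← threeTerm_levelProb hπ hm n, threeTerm, hα] at hin
  linarith only [hin]

lemma phaseRoots (hπ : IsPositiveSteadyState C.q π) (hm : m ≤ M) (hlam : 0 < C.lam m)
    (hmu : 0 < C.mu m) :
    PhaseRoots (C.lam m + C.mu m + C.alpha m) (C.lam m) (C.mu m) (C.r m)
      (C.phi m (C.alpha m)) := by
  rw [r, if_pos hmu, rho]
  exact phaseRoots_of_busyPeriod hlam hmu C.alpha_nonneg (lam_lt_mu hπ hm hlam) rfl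

lemma phi_last (hlam : 0 < C.lam M) (hlt : C.lam M < C.mu M) : C.phi M (C.alpha M) = 1 := by
  have hdiscr : (0 + C.lam M + C.mu M) ^ 2 - 4 * C.lam M * C.mu M = (C.mu M - C.lam M) ^ 2 := by
    ring
  rw [alpha_last, phi, hdiscr, Real.sqrt_sq (sub_pos.2 hlt).le]
  field_simp
  ring

end ClassM

end LevelProb

noncomputable section Coefficients

namespace ClassM

variable {N : Type*} {M j₀ : ℕ} (C : ClassM N M j₀) {p : ℕ → ℝ} {m k : ℕ}

/-- The coefficients `c_{m,k}`, determined recursively from the values `p m` of `π_{(m, j₀)}`. The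
indices `m = M`, `k ≥ M` give the coefficient `c_{M,M}` of the base `r_M`. -/
def coeff (C : ClassM N M j₀) (p : ℕ → ℝ) (m k : ℕ) : ℝ :=
  if m < M then
    if k = 0 then p m
    else ∑ i : Fin m, sameBaseCoeff m (C.lam m) (C.r 0) (C.phi m (C.alpha m)) (C.alp i (m - i))
      (coeff C p i) k
  else
    let x := fun l => ∑ i : Fin m, newBaseCoeff m (C.lam m) (C.r 0) (C.r m) (C.phi m (C.alpha m))
      (C.alp i (m - i)) (coeff C p i) l
    if k < M then x k else p m - x 0
termination_by m

lemma coeff_zero (hm : m < M) : C.coeff p m 0 = p m := by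
  rw [coeff, if_pos hm, if_pos rfl]

lemma coeff_of_ne_zero (hm : m < M) (hk : k ≠ 0) :
    C.coeff p m k = ∑ i ∈ Finset.range m, sameBaseCoeff m (C.lam m) (C.r 0)
      (C.phi m (C.alpha m)) (C.alp i (m - i)) (C.coeff p i) k := by
  rw [coeff, if_pos hm, if_neg hk, Finset.sum_range]

lemma coeff_last (hk : k < M) :
    C.coeff p M k = ∑ i ∈ Finset.range M, newBaseCoeff M (C.lam M) (C.r 0) (C.r M)
      (C.phi M (C.alpha M)) (C.alp i (M - i)) (C.coeff p i) k := by
  rw [coeff, if_neg (lt_irrefl M), if_pos hk, Finset.sum_range]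

lemma coeff_last_self (hM : 0 < M) : C.coeff p M M = p M - C.coeff p M 0 := by
  rw [coeff_last _ hM, coeff, if_neg (lt_irrefl M), if_neg (lt_irrefl M), Finset.sum_range]

lemma coeff_eq_zero (hm : m < M) (hk : m < k) : C.coeff p m k = 0 := by
  induction m using Nat.strong_induction_on generalizing k with
  | _ m ih =>
    rw [coeff_of_ne_zero _ hm (Nat.ne_zero_of_lt hk)]
    refine Finset.sum_eq_zero fun i hi => sameBaseCoeff_of_lt (fun u hu => ?_) hk
    have hi := Finset.mem_range.1 hi
    exact ih i hi (hi.trans hm) (hi.trans_le hu)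

lemma coeff_mid (hr0 : C.r 0 ≠ 0) (hr : C.r m = C.r 0) (hm : m < M) (hk : k ≠ 0) :
    C.coeff p m k =
      C.Omega m * C.r 0 * (∑ u ∈ Finset.Ico k m, ∑ i ∈ Finset.Ico u m, C.coeff p i u *
        ∑ Δ ∈ Finset.Icc (-1 : ℤ) 1, C.alp i (m - i) Δ * C.phi m (C.alpha m) ^ (Δ + 1) /
          (1 - C.r 0 * C.phi m (C.alpha m)) ^ (u + 1 - k))
      + C.Omega m * (∑ i ∈ Finset.Ico (k - 1) m, C.coeff p i (k - 1) *
        ∑ Δ ∈ Finset.Icc (-1 : ℤ) 1, C.alp i (m - i) Δ * C.r 0 ^ (-Δ))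
      - 1 / C.lam m * ∑ i ∈ Finset.Ico k m, C.coeff p i k * C.alp i (m - i) 1 := by
  have hc : ∀ i < m, ∀ u, i < u → C.coeff p i u = 0 := fun i hi u => C.coeff_eq_zero (hi.trans hm)
  simp only [sum_mul_zpow_neg hr0, ← Finset.sum_div, sum_mul_zpow_add_one]
  rw [← sum_shiftResolvent_mul hc, ← sum_range_mul_eq_sum_Ico fun i hi => hc i hi (k - 1),
    ← sum_range_mul_eq_sum_Ico fun i hi => hc i hi k, coeff_of_ne_zero _ hm hk]
  simp only [sameBaseCoeff, Omega, hr, Finset.mul_sum, ← Finset.sum_add_distrib,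
    ← Finset.sum_sub_distrib]
  exact Finset.sum_congr rfl fun i _ => by ring

lemma coeff_diag (hr0 : C.r 0 ≠ 0) (hr : C.r m = C.r 0) (hm0 : 1 ≤ m) (hm : m < M) :
    C.coeff p m m = C.coeff p (m - 1) (m - 1) * C.Omega m *
      ∑ Δ ∈ Finset.Icc (-1 : ℤ) 1, C.alp (m - 1) 1 Δ * C.r 0 ^ (-Δ) := by
  obtain ⟨m, rfl⟩ := Nat.exists_eq_add_of_le' hm0
  rw [coeff_mid _ hr0 hr hm m.add_one_ne_zero, Nat.add_sub_cancel, Finset.Ico_self,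
    Nat.Ico_succ_singleton, Finset.sum_singleton, Nat.add_sub_cancel_left]
  simp only [Finset.sum_empty]
  ring

lemma coeff_last_eq (hφ : C.phi M (C.alpha M) = 1) (hk : k < M) :
    C.coeff p M k =
      - (∑ i ∈ Finset.Ico k M, C.coeff p i k * (C.alp i (M - i) 1 / C.lam M))
      + ∑ u ∈ Finset.Ico k M, ∑ i ∈ Finset.Ico u M, C.coeff p i u * C.Omega M * C.r 0 *
        ∑ Δ ∈ Finset.Icc (-1 : ℤ) 1, C.alp i (M - i) Δ *
          (1 / (1 - C.r 0) ^ (u + 1 - k)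
            - 1 / (C.r M ^ (Δ + 1) * (1 - C.r 0 / C.r M) ^ (u + 1 - k))) := by
  have hc : ∀ i < M, ∀ u, i < u → C.coeff p i u = 0 := fun i hi u => C.coeff_eq_zero hi
  have hsplit : ∀ a b : ℝ, ∑ u ∈ Finset.Ico k M, ∑ i ∈ Finset.Ico u M,
        C.coeff p i u * C.Omega M * C.r 0 * (stepPoly (C.alp i (M - i)) 1 / a ^ (u + 1 - k)
          - stepPoly (C.alp i (M - i)) (C.r M)⁻¹ / b ^ (u + 1 - k))
      = C.Omega M * C.r 0 * (∑ i ∈ Finset.range M,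
          (shiftResolvent M a (C.coeff p i) k * stepPoly (C.alp i (M - i)) 1
            - shiftResolvent M b (C.coeff p i) k * stepPoly (C.alp i (M - i)) (C.r M)⁻¹)) :=
    fun a b => by
      rw [Finset.sum_sub_distrib, sum_shiftResolvent_mul hc, sum_shiftResolvent_mul hc]
      simp only [Finset.mul_sum, ← Finset.sum_sub_distrib]
      exact Finset.sum_congr rfl fun u _ => Finset.sum_congr rfl fun i _ => by ring
  simp only [sum_mul_one_div_sub_one_div, hsplit]
  rw [← sum_range_mul_eq_sum_Ico fun i hi => hc i hi k, coeff_last _ hk, hφ, Finset.mul_sum,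
    neg_add_eq_sub, ← Finset.sum_sub_distrib]
  simp only [newBaseCoeff, Omega, hφ, mul_one]
  exact Finset.sum_congr rfl fun i _ => by ring

end ClassM

end Coefficients

noncomputable section SteadyState

namespace ClassM

open MState

variable {N : Type*} {M j₀ : ℕ} {C : ClassM N M j₀} {π : MState N M j₀ → ℝ} {m : ℕ}

/-- The coefficients `c_{m,k}` of the steady-state distribution `π`. -/
def steadyCoeff (C : ClassM N M j₀) (π : MState N M j₀ → ℝ) : ℕ → ℕ → ℝ :=
  C.coeff fun m => levelProb π m 0

lemma steadyCoeff_eq_zero {k : ℕ} (hm : m < M) (hk : m < k) : C.steadyCoeff π m k = 0 :=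
  C.coeff_eq_zero hm hk

lemma pos_of_r_ne (hrM : C.r M ≠ C.r 0) : 0 < M :=
  Nat.pos_of_ne_zero fun h => hrM (h ▸ rfl)

lemma phaseRoots_base (hπ : IsPositiveSteadyState C.q π) (hlam : ∀ m, m ≤ M → 0 < C.lam m)
    (hmu : ∀ m, m ≤ M → 0 < C.mu m) (hr : ∀ m, m < M → C.r m = C.r 0) (hm : m < M) :
    PhaseRoots (C.lam m + C.mu m + C.alpha m) (C.lam m) (C.mu m) (C.r 0) (C.phi m (C.alpha m)) :=
  hr m hm ▸ phaseRoots hπ hm.le (hlam m hm.le) (hmu m hm.le)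

lemma threeTerm_levelProb_eq_sum_binomSum (hπ : IsPositiveSteadyState C.q π) (hm : m ≤ M)
    (hlow : ∀ i < m, ∀ n, levelProb π i n = binomSum (i + 1) (C.steadyCoeff π i) n * C.r 0 ^ n)
    (n : ℕ) :
    threeTerm (-C.mu m) (C.lam m + C.mu m + C.alpha m) (-C.lam m) (levelProb π m) n
      = ∑ i ∈ Finset.range m, threeTerm (C.alp i (m - i) (-1)) (C.alp i (m - i) 0)
          (C.alp i (m - i) 1) (fun n => binomSum m (C.steadyCoeff π i) n * C.r 0 ^ n) n := by
  rw [threeTerm_levelProb hπ hm]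
  refine Finset.sum_congr rfl fun i hi => ?_
  have him := Finset.mem_range.1 hi
  rw [funext (hlow i him),
    funext (binomSum_of_le him fun k => steadyCoeff_eq_zero (him.trans_le hm))]

lemma levelProb_eq_binomSum (hπ : IsPositiveSteadyState C.q π) (hlam : ∀ m, m ≤ M → 0 < C.lam m)
    (hmu : ∀ m, m ≤ M → 0 < C.mu m) (hr : ∀ m, m < M → C.r m = C.r 0) (hm : m < M) (n : ℕ) :
    levelProb π m n = binomSum (m + 1) (C.steadyCoeff π m) n * C.r 0 ^ n := by
  induction m using Nat.strong_induction_on generalizing n with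
  | _ m ih =>
    exact (phaseRoots_base hπ hlam hmu hr hm).eq_binomSum_of_sameBase
      (α := fun i => C.alp i (m - i)) (x := C.steadyCoeff π m)
      (fun i hi k hk => have him := Finset.mem_range.1 hi
        steadyCoeff_eq_zero (him.trans hm) (him.trans_le hk))
      (threeTerm_levelProb_eq_sum_binomSum hπ hm.le fun i hi => ih i hi (hi.trans hm))
      (summable_levelProb hπ.hasSum_one.summable m).tendsto_atTop_zero (C.coeff_zero hm)
      (fun k => C.coeff_of_ne_zero hm k.succ_ne_zero) n

lemma levelProb_last_eq_binomSum (hπ : IsPositiveSteadyState C.q π)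
    (hlam : ∀ m, m ≤ M → 0 < C.lam m) (hmu : ∀ m, m ≤ M → 0 < C.mu m)
    (hr : ∀ m, m < M → C.r m = C.r 0) (hrM : C.r M ≠ C.r 0) (n : ℕ) :
    levelProb π M n = binomSum M (C.steadyCoeff π M) n * C.r 0 ^ n
      + C.steadyCoeff π M M * C.r M ^ n := by
  have hM := pos_of_r_ne hrM
  have h0 := phaseRoots_base hπ hlam hmu hr hM
  have hlast := phaseRoots hπ le_rfl (hlam M le_rfl) (hmu M le_rfl)
  have hx : ∀ k < M, C.steadyCoeff π M k = ∑ i ∈ Finset.range M, newBaseCoeff M (C.lam M) (C.r 0)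
      (C.r M) (C.phi M (C.alpha M)) (C.alp i (M - i)) (C.steadyCoeff π i) k := fun k => C.coeff_last
  have hself : C.steadyCoeff π M M = levelProb π M 0 - C.steadyCoeff π M 0 := C.coeff_last_self hM
  rw [hself, hx 0 hM, hlast.eq_binomSum_of_newBase h0.r_pos.ne' h0.norm_lt_one
    (h0.one_sub_mul_ne_zero hlast.f_le_one) hrM.symm
    (fun i hi k hk => have hiM := Finset.mem_range.1 hi
      steadyCoeff_eq_zero hiM (hiM.trans_le hk))
    (α := fun i => C.alp i (M - i))
    (threeTerm_levelProb_eq_sum_binomSum hπ le_rfl fun i => levelProb_eq_binomSum hπ hlam hmu hr)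
    (summable_levelProb hπ.hasSum_one.summable M).tendsto_atTop_zero (fun _ => rfl) n]
  congr 2
  exact Finset.sum_congr rfl fun k hk => congrArg (· * _) (hx k (Finset.mem_range.1 hk)).symm

end ClassM

end SteadyState

section LinearSystem

namespace ClassM

open MState

variable {N : Type*} {M j₀ : ℕ} {C : ClassM N M j₀} {π : MState N M j₀ → ℝ}

lemma prob_lvl_one (hπ : IsPositiveSteadyState C.q π) (hlam : ∀ m, m ≤ M → 0 < C.lam m)
    (hmu : ∀ m, m ≤ M → 0 < C.mu m) (hr : ∀ m, m < M → C.r m = C.r 0) {m : Fin (M + 1)}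
    (hm : (m : ℕ) < M) :
    π (lvl m 1) = ∑ k ∈ Finset.range ((m : ℕ) + 1), C.steadyCoeff π m k * C.r 0 := by
  rw [← levelProb_val (π := π), levelProb_eq_binomSum hπ hlam hmu hr hm, binomSum_one, pow_one,
    Finset.sum_mul]

lemma prob_lvl_last_one (hπ : IsPositiveSteadyState C.q π) (hlam : ∀ m, m ≤ M → 0 < C.lam m)
    (hmu : ∀ m, m ≤ M → 0 < C.mu m) (hr : ∀ m, m < M → C.r m = C.r 0) (hrM : C.r M ≠ C.r 0) :
    π (lvl (Fin.last M) 1) = (∑ k ∈ Finset.range M, C.steadyCoeff π M k * C.r 0)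
      + C.steadyCoeff π M M * C.r M := by
  rw [← levelProb_val (π := π), Fin.val_last, levelProb_last_eq_binomSum hπ hlam hmu hr hrM,
    binomSum_one, pow_one, pow_one, Finset.sum_mul]

variable [Fintype N]

lemma balance_lvl_zero (hπ : IsPositiveSteadyState C.q π) (hlam : ∀ m, m ≤ M → 0 < C.lam m)
    (hmu : ∀ m, m ≤ M → 0 < C.mu m) (hr : ∀ m, m < M → C.r m = C.r 0) (m : Fin (M + 1)) :
    π (lvl m 0) * (C.lam m
        + (∑ i ∈ Finset.Icc ((m : ℕ) + 1) M, ∑ Δ ∈ Finset.Icc (0 : ℤ) 1, C.alp m (i - m) Δ)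
        + ∑ x : N, C.q (lvl m 0) (non x))
      = C.mu m * π (lvl m 1) + (∑ x : N, C.q (non x) (lvl m 0) * π (non x))
        + ∑ i ∈ Finset.Iio m, (C.alp i ((m : ℕ) - i) 0 * π (lvl i 0) + C.alp i ((m : ℕ) - i) (-1) *
          ∑ k ∈ Finset.range ((i : ℕ) + 1), C.steadyCoeff π i k * C.r 0) := by
  rw [← (C.hasSum_out_zero m).tsum_eq, (hπ.balance _).unique (C.hasSum_in_zero π m)]
  congr 1
  refine Finset.sum_congr rfl fun i hi => ?_
  rw [prob_lvl_one hπ hlam hmu hr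
    ((Fin.lt_def.1 (Finset.mem_Iio.1 hi)).trans_le (Nat.le_of_lt_succ m.2))]

lemma balance_nonrepeating (hπ : IsPositiveSteadyState C.q π) (x : N) :
    π (non x) * ((∑ m, C.q (non x) (lvl m 0)) + ∑ y, C.q (non x) (non y))
      = (∑ m, C.q (lvl m 0) (non x) * π (lvl m 0)) + ∑ y, C.q (non y) (non x) * π (non y) := by
  rw [← (C.hasSum_out_non x).tsum_eq, (hπ.balance _).unique (C.hasSum_in_non π x)]

lemma normalization_steadyCoeff (hπ : IsPositiveSteadyState C.q π)
    (hlam : ∀ m, m ≤ M → 0 < C.lam m) (hmu : ∀ m, m ≤ M → 0 < C.mu m)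
    (hr : ∀ m, m < M → C.r m = C.r 0) (hrM : C.r M ≠ C.r 0) :
    (∑ x, π (non x))
      + (∑ m ∈ Finset.range M, (C.steadyCoeff π m 0 / (1 - C.r 0)
          + ∑ k ∈ Finset.Icc 1 m, C.steadyCoeff π m k * C.r 0 / (1 - C.r 0) ^ (k + 1)))
      + (C.steadyCoeff π M 0 / (1 - C.r 0)
          + (∑ k ∈ Finset.Ico 1 M, C.steadyCoeff π M k * C.r 0 / (1 - C.r 0) ^ (k + 1))
          + C.steadyCoeff π M M / (1 - C.r M)) = 1 := by
  have hM := pos_of_r_ne hrM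
  have h0 := (phaseRoots_base hπ hlam hmu hr hM).norm_lt_one
  have hlast := (phaseRoots hπ le_rfl (hlam M le_rfl) (hmu M le_rfl)).norm_lt_one
  refine Eq.trans ?_ (sum_add_sum_tsum_levelProb hπ.hasSum_one)
  congr 2
  · refine Finset.sum_congr rfl fun m hm => ?_
    rw [tsum_congr (levelProb_eq_binomSum hπ hlam hmu hr (Finset.mem_range.1 hm)),
      (hasSum_binomSum h0 m.add_one_pos _).tsum_eq, Finset.Ico_add_one_right_eq_Icc]
  · rw [tsum_congr (levelProb_last_eq_binomSum hπ hlam hmu hr hrM), div_eq_mul_inv _ (1 - C.r M)]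
    exact ((hasSum_binomSum h0 hM _).add
      ((hasSum_geometric_of_norm_lt_one hlast).mul_left _)).tsum_eq.symm

lemma linearSystem_steadyCoeff (hπ : IsPositiveSteadyState C.q π)
    (hlam : ∀ m, m ≤ M → 0 < C.lam m) (hmu : ∀ m, m ≤ M → 0 < C.mu m)
    (hr : ∀ m, m < M → C.r m = C.r 0) (hrM : C.r M ≠ C.r 0) :
    C.LinearSystem (C.steadyCoeff π) (fun m => π (rep m j₀ le_rfl)) fun x => π (non x) := by
  have hM := pos_of_r_ne hrM
  have hr0 : C.r 0 ≠ 0 := (phaseRoots_base hπ hlam hmu hr hM).r_pos.ne'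
  have hφ : C.phi M (C.alpha M) = 1 := phi_last (hlam M le_rfl) <|
    lam_lt_mu hπ le_rfl (hlam M le_rfl) C.alpha_last
  exact
    { coeff_zero := fun m hm => (C.coeff_zero hm).trans (levelProb_val m 0)
      coeff_mid := fun m k hk _ hm => C.coeff_mid hr0 (hr m hm) hm (Nat.ne_zero_of_lt hk)
      coeff_diag := fun m hm0 hm => C.coeff_diag hr0 (hr m hm) hm0 hm
      coeff_last := fun k hk => C.coeff_last_eq hφ hk
      coeff_last_diag := (C.coeff_last_self hM).trans <|
        congrArg (· - _) (levelProb_val (Fin.last M) 0)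
      balance_rep := fun m hm =>
        prob_lvl_one hπ hlam hmu hr hm ▸ balance_lvl_zero hπ hlam hmu hr m
      balance_rep_last := by
        have h := balance_lvl_zero hπ hlam hmu hr (Fin.last M)
        rw [prob_lvl_last_one hπ hlam hmu hr hrM, Fin.val_last,
          Finset.Icc_eq_empty (by omega), Finset.sum_empty, add_zero] at h
        exact h
      balance_non := balance_nonrepeating hπ
      normalization := normalization_steadyCoeff hπ hlam hmu hr hrM }

end ClassM

end LinearSystem

theorem theorem5_general {N : Type*} [Fintype N] (M j₀ : ℕ) (C : ClassM N M j₀)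
    (π : MState N M j₀ → ℝ) (hπ : IsPositiveSteadyState C.q π)
    (hlam : ∀ m, m ≤ M → 0 < C.lam m) (hmu : ∀ m, m ≤ M → 0 < C.mu m)
    (hr : ∀ m, m < M → C.r m = C.r 0) (hrM : C.r M ≠ C.r 0) :
    ∃ c : ℕ → ℕ → ℝ,
      (∀ (m : Fin (M + 1)) (j : ℕ) (hj : j₀ ≤ j), (m : ℕ) < M →
        π (MState.rep m j hj)
          = ∑ k ∈ Finset.range ((m : ℕ) + 1),
              c m k * (Nat.choose (j - j₀ + k - 1) k : ℝ) * C.r 0 ^ (j - j₀)) ∧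
      (∀ (j : ℕ) (hj : j₀ ≤ j),
        π (MState.rep (Fin.last M) j hj)
          = (∑ k ∈ Finset.range M,
              c M k * (Nat.choose (j - j₀ + k - 1) k : ℝ) * C.r 0 ^ (j - j₀))
            + c M M * C.r M ^ (j - j₀)) ∧
      C.LinearSystem c (fun m => π (MState.rep m j₀ le_rfl)) (fun x => π (MState.non x)) := by
  refine ⟨C.steadyCoeff π, fun m j hj hm => ?_, fun j hj => ?_,
    ClassM.linearSystem_steadyCoeff hπ hlam hmu hr hrM⟩
  · rw [MState.rep_eq_lvl, ← MState.levelProb_val (π := π),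
      ClassM.levelProb_eq_binomSum hπ hlam hmu hr hm, binomSum, Finset.sum_mul]
    simp only [Nat.multichoose_eq]
  · rw [MState.rep_eq_lvl, ← MState.levelProb_val (π := π), Fin.val_last,
      ClassM.levelProb_last_eq_binomSum hπ hlam hmu hr hrM, binomSum, Finset.sum_mul]
    simp only [Nat.multichoose_eq]

theorem theorem5 {N : Type*} [Fintype N] (M j₀ : ℕ) (C : ClassM N M j₀)
    (P : ℝ → MState N M j₀ → MState N M j₀ → ℝ) (hP : IsTransitionFunction C.q P)
    (herg : IsErgodicChain P)
    (π : MState N M j₀ → ℝ) (hπ : IsLimitingDistribution P π)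
    (hlam : ∀ m, m ≤ M → 0 < C.lam m) (hmu : ∀ m, m ≤ M → 0 < C.mu m)
    (hr : ∀ m, m < M → C.r m = C.r 0) (hrM : C.r M ≠ C.r 0) :
    ∃ c : ℕ → ℕ → ℝ,
      (∀ (m : Fin (M + 1)) (j : ℕ) (hj : j₀ ≤ j), (m : ℕ) < M →
        π (MState.rep m j hj)
          = ∑ k ∈ Finset.range ((m : ℕ) + 1),
              c m k * (Nat.choose (j - j₀ + k - 1) k : ℝ) * C.r 0 ^ (j - j₀)) ∧
      (∀ (j : ℕ) (hj : j₀ ≤ j),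
        π (MState.rep (Fin.last M) j hj)
          = (∑ k ∈ Finset.range M,
              c M k * (Nat.choose (j - j₀ + k - 1) k : ℝ) * C.r 0 ^ (j - j₀))
            + c M M * C.r M ^ (j - j₀)) ∧
      C.LinearSystem c (fun m => π (MState.rep m j₀ le_rfl)) (fun x => π (MState.non x)) := by
  obtain ⟨K, hK⟩ := C.exists_exit_rate_le
  exact theorem5_general M j₀ C π (hπ.isPositiveSteadyState hP herg.irreducible C.q_self hK)
    hlam hmu hr hrM
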